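/- For an index $\mathbf k=(k_1,\dots,k_r)$ of positive integers ($r\ge 1$) let $$\bar T(k_1,\dots,k_r)=2^r\sum_{0<n_1<\cdots<n_r}\frac{(-1)^{n_r}}{(2n_1-1)^{k_1}(2n_2-2)^{k_2}\cdots(2n_r-r)^{k_r}},$$ where the series is understood as the limit, as $N\to\infty$, of its truncations to $n_r\le N$. Let $W(k,r)=\sum \bar T(k_1,\dots,k_r)$, the sum being over all indices of positive integers of depth $r$ with $k_1+\cdots+k_r=k$. Let $\bar\zeta(s)=\sum_{n\ge 1}(-1)^{n-1}n^{-s}$ for integers $s\ge 1$ and $\bar\zeta(0)=\tfrac12$. For integers $1\le j\le p$ put $Z(p,p)=1$ and, if $j<p$, $$Z(j,p)=\sum_{k=1}^{p-j}(-2)^k\sum_{j=i_0<i_1<\cdots<i_k=p}\ \prod_{l=1}^{k}\bar\zeta(2i_l-2i_{l-1}).$$ **Theorem 1.1.** The series defining $\bar T(k_1,\dots,k_r)$ (for all $r\ge 1$ and all positive integers $k_1,\dots,k_r$) and $\bar\zeta(s)$ (for all $s\ge 1$) converge, and for all positive integers $m$ and $p$, $$(-1)^m\sum_{j=1}^{p}W(2j+2m-1,2m)\,Z(j,p)=(-1)^p\sum_{j=1}^{m}W(2j+2p-1,2p)\,Z(j,m).$$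 -/

import Mathlib

open Filter Topology

namespace AltMTV

/-- The set `I(k, r)` of all indices `(k₁, …, k_r)` (sequences of positive integers) of depth `r`
and weight `k₁ + ⋯ + k_r = k`. -/
def indices (k r : ℕ) : Finset (Fin r → ℕ) :=
  (Finset.Nat.antidiagonalTuple r k).filter fun κ => ∀ i, 1 ≤ κ i

open Classical in
/-- All integer sequences `a ≤ n₁ < ⋯ < n_r ≤ b`. -/
noncomputable def chains (r a b : ℕ) : Finset (Fin r → ℕ) :=
  (Fintype.piFinset fun _ : Fin r => Finset.Icc a b).filter fun n => StrictMono n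

/-- The truncation to `n_r ≤ N` of the series defining the alternating multiple `T`-value:
`2^r ∑_{0 < n₁ < ⋯ < n_r ≤ N} (-1)^{n_r} / ((2n₁-1)^{k₁} (2n₂-2)^{k₂} ⋯ (2n_r-r)^{k_r})`.
The position `j : Fin r` stands for the subscript `j + 1`, so the sign is attached to the last
position only. -/
noncomputable def TBarPartial {r : ℕ} (κ : Fin r → ℕ) (N : ℕ) : ℝ :=
  2 ^ r * ∑ n ∈ chains r 1 N, ∏ j : Fin r,
    (if (j : ℕ) + 1 = r then (-1 : ℝ) ^ n j else 1) /
      (2 * (n j : ℝ) - ((j : ℕ) + 1 : ℝ)) ^ κ j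

/-- The alternating multiple `T`-value `T̄(k₁, …, k_r)`. The series is summed in the order of
increasing outermost variable `n_r`; for `k_r = 1` it converges only conditionally. -/
noncomputable def TBar {r : ℕ} (κ : Fin r → ℕ) : ℝ :=
  limUnder atTop (TBarPartial κ)

/-- `W(k, r)`, the sum of `T̄(k₁, …, k_r)` over all indices of weight `k` and depth `r`. -/
noncomputable def W (k r : ℕ) : ℝ :=
  ∑ κ ∈ indices k r, TBar κ

/-- The partial sum `∑_{n=1}^N (-1)^{n-1} / n^s`. -/
noncomputable def zetaBarPartial (s N : ℕ) : ℝ :=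
  ∑ n ∈ Finset.Icc 1 N, (-1 : ℝ) ^ (n - 1) / (n : ℝ) ^ s

/-- The alternating zeta value `ζ̄(s) = ∑_{n ≥ 1} (-1)^{n-1} / n^s` for `s ≥ 1`, and
`ζ̄(0) = 1/2`. -/
noncomputable def zetaBar (s : ℕ) : ℝ :=
  if s = 0 then 1 / 2 else limUnder atTop (zetaBarPartial s)

/-- `Z(j, p)` for `1 ≤ j ≤ p`: it is `1` if `j = p`, and otherwise
`∑_{k=1}^{p-j} (-2)^k ∑_{j = i₀ < i₁ < ⋯ < i_k = p} ∏_{l=1}^k ζ̄(2 i_l - 2 i_{l-1})`. -/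
noncomputable def Z (j p : ℕ) : ℝ :=
  if j = p then 1
  else ∑ k ∈ Finset.Icc 1 (p - j), (-2 : ℝ) ^ k *
    ∑ i ∈ (chains (k + 1) j p).filter (fun i => i 0 = j ∧ i (Fin.last k) = p),
      ∏ l : Fin k, zetaBar (2 * i l.succ - 2 * i l.castSucc)

end AltMTV

namespace AltMTV

/-! With gd the Gudermannian function (gd' = sech, gd 0 = 0), summing over all indices of fixed
weight and depth collapses the nested series to a single integral: W(a+r+1, r+1) = (-1)^(r+1) ∫_0^∞
t^a/a! · gd(t)^r/r! · sech t dt (`W_eq_gdMoment`). The generating series in e^(-t) obeys the same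
recursion in (a, r) as the tail integrals, and Abel's theorem takes t to 0.

The numbers Z(j, p) are the coefficients of sin(πx)/(πx) (`Z_eq_sincCoeff`), because 2 ∑ ζ̄(2e)
x^(2e) = πx / sin(πx) and the alternating chain sum inverts that series. Hence π ∑_j W(2j+2m-1, 2m)
Z(j, p) is the integral of gd^(2m-1)/(2m-1)! · sech t against Im (t+iπ)^(2p)/(2p)! (`sum_W_mul_Z`).

These integrals are, up to sign, the coefficients in x and y of sin(πx) · y ∫ sinh(xt) sin(y gd t)
sech t dt, so the theorem says that this function is symmetric in x and y. The symmetry comes from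
integrating e^(xS) (tanh(S/2)^y - 1) around a half-strip: S ↦ tanh(S/2) turns e^(-S) into its Cayley
transform, an involution, so the bottom and left edges carry the same kind of integral with x and y
exchanged (`integral_exp_cos_add`). Antisymmetrising gives an identity for 0 < x, y < 1; analyticity
in y extends it to small negative y, and combining y with -y gives the symmetric form
(`eventually_integral_sinh_sin_symm`). Coefficients are then compared in y and afterwards in x
(`integral_imPow_symm`). -/

/-! ### Recursions for chains, indices and truncated nested sums. -/

theorem mem_chains {r a b : ℕ} {n : Fin r → ℕ} :
    n ∈ chains r a b ↔ (∀ i, a ≤ n i ∧ n i ≤ b) ∧ StrictMono n := by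
  simp [chains, Fintype.mem_piFinset]

theorem mem_indices {k r : ℕ} {κ : Fin r → ℕ} :
    κ ∈ indices k r ↔ ∑ i, κ i = k ∧ ∀ i, 1 ≤ κ i := by
  simp [indices, Finset.Nat.mem_antidiagonalTuple]

theorem strictMono_snoc_iff {r : ℕ} {n : Fin r → ℕ} {q : ℕ} :
    StrictMono (Fin.snoc n q : Fin (r + 1) → ℕ) ↔ StrictMono n ∧ ∀ i, n i < q := by
  constructor
  · intro h
    refine ⟨fun i j hij => ?_, fun i => ?_⟩
    · simpa using h (Fin.castSucc_lt_castSucc_iff.2 hij)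
    · simpa using h (Fin.castSucc_lt_last i)
  · rintro ⟨h, hq⟩ i j hij
    induction j using Fin.lastCases with
    | last =>
      induction i using Fin.lastCases with
      | last => exact absurd hij (lt_irrefl _)
      | cast i => simpa using hq i
    | cast j =>
      induction i using Fin.lastCases with
      | last => exact absurd hij (not_lt.2 (Fin.le_last _))
      | cast i => simpa using h (Fin.castSucc_lt_castSucc_iff.1 hij)

/-- Splitting off the largest term of a chain. -/
theorem sum_chains_succ {r a N : ℕ} (ha : 1 ≤ a) (F : (Fin (r + 1) → ℕ) → ℝ) :
    ∑ n ∈ chains (r + 1) a N, F n =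
      ∑ q ∈ Finset.Icc a N, ∑ n ∈ chains r a (q - 1), F (Fin.snoc n q) := by
  rw [Finset.sum_sigma']
  refine Finset.sum_bij' (fun n _ => ⟨n (Fin.last r), Fin.init n⟩) (fun x _ => Fin.snoc x.2 x.1)
    ?_ ?_ ?_ ?_ ?_
  · intro n hn
    rw [← Fin.snoc_init_self n, mem_chains, strictMono_snoc_iff] at hn
    obtain ⟨h1, h2, h3⟩ := hn
    simp only [Finset.mem_sigma, Finset.mem_Icc, mem_chains]
    refine ⟨by simpa using h1 (Fin.last r), fun i => ⟨by simpa using (h1 i.castSucc).1, ?_⟩, h2⟩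
    have := h3 i
    omega
  · rintro ⟨q, n⟩ hx
    simp only [Finset.mem_sigma, Finset.mem_Icc, mem_chains] at hx
    obtain ⟨⟨h1, h2⟩, h3, h4⟩ := hx
    rw [mem_chains, strictMono_snoc_iff]
    refine ⟨fun i => ?_, h4, fun i => ?_⟩
    · induction i using Fin.lastCases with
      | last => simpa using ⟨h1, h2⟩
      | cast i =>
        have := h3 i
        simp only [Fin.snoc_castSucc]
        omega
    · have := h3 i
      show n i < q
      omega
  · intro n _; simp
  · rintro ⟨q, n⟩ _; simp
  · intro n _; simp

theorem sum_Icc_one_eq_sum_range (N : ℕ) (f : ℕ → ℝ) :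
    ∑ q ∈ Finset.Icc 1 N, f q = ∑ n ∈ Finset.range N, f (n + 1) := by
  induction N with
  | zero => simp
  | succ N ih => rw [Finset.sum_Icc_succ_top (by omega), ih, Finset.sum_range_succ]

/-- The unsigned nested sum `∑_{0 < n₁ < ⋯ < n_r ≤ N} ∏ (2 n_j - j)^{-k_j}`. -/
noncomputable def nestedSum {r : ℕ} (κ : Fin r → ℕ) (N : ℕ) : ℝ :=
  ∑ n ∈ chains r 1 N, ∏ j : Fin r, 1 / (2 * (n j : ℝ) - ((j : ℕ) + 1 : ℝ)) ^ κ j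

theorem nestedSum_zero (κ : Fin 0 → ℕ) (N : ℕ) : nestedSum κ N = 1 := by
  have : chains 0 1 N = {Fin.elim0} := by
    ext n
    simp only [mem_chains, Finset.mem_singleton]
    exact ⟨fun _ => Subsingleton.elim _ _, fun _ => ⟨fun i => i.elim0, fun i => i.elim0⟩⟩
  simp [nestedSum, this]

theorem nestedSum_succ {r : ℕ} (κ : Fin (r + 1) → ℕ) (N : ℕ) :
    nestedSum κ N = ∑ n ∈ Finset.range N,
      nestedSum (Fin.init κ) n / (2 * (n : ℝ) + 1 - r) ^ κ (Fin.last r) := by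
  rw [nestedSum, sum_chains_succ le_rfl, sum_Icc_one_eq_sum_range]
  refine Finset.sum_congr rfl fun n _ => ?_
  rw [nestedSum, Finset.sum_div]
  refine Finset.sum_congr (by simp) fun x _ => ?_
  rw [Fin.prod_univ_castSucc]
  simp only [Fin.snoc_castSucc, Fin.snoc_last, Fin.val_castSucc, Fin.val_last, Fin.init]
  push_cast
  rw [show (2 * ((n : ℝ) + 1) - (r + 1)) = 2 * (n : ℝ) + 1 - r by ring]
  ring

theorem TBarPartial_succ {r : ℕ} (κ : Fin (r + 1) → ℕ) (N : ℕ) :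
    TBarPartial κ N = 2 ^ (r + 1) * ∑ n ∈ Finset.range N, (-1) ^ (n + 1) *
      (nestedSum (Fin.init κ) n / (2 * (n : ℝ) + 1 - r) ^ κ (Fin.last r)) := by
  rw [TBarPartial, sum_chains_succ le_rfl, sum_Icc_one_eq_sum_range]
  congr 1
  refine Finset.sum_congr rfl fun n _ => ?_
  rw [nestedSum, Finset.sum_div, Finset.mul_sum]
  refine Finset.sum_congr (by simp) fun x _ => ?_
  rw [Fin.prod_univ_castSucc]
  simp only [Fin.snoc_castSucc, Fin.snoc_last, Fin.val_castSucc, Fin.val_last, Fin.init,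
    if_true]
  have : ∀ j : Fin r, ¬ ((j : ℕ) + 1 = r + 1) := fun j => by omega
  simp only [this, if_false]
  push_cast
  rw [show (2 * ((n : ℝ) + 1) - (r + 1)) = 2 * (n : ℝ) + 1 - r by ring]
  ring

/-- Splitting off the last entry of an index. -/
theorem sum_indices_succ (a r : ℕ) (F : (Fin (r + 1) → ℕ) → ℝ) :
    ∑ κ ∈ indices (a + r + 1) (r + 1), F κ =
      ∑ l ∈ Finset.range (a + 1), ∑ κ ∈ indices (a - l + r) r, F (Fin.snoc κ (l + 1)) := by
  rw [Finset.sum_sigma']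
  refine Finset.sum_bij' (fun n _ => ⟨n (Fin.last r) - 1, Fin.init n⟩)
    (fun x _ => Fin.snoc x.2 (x.1 + 1)) ?_ ?_ ?_ ?_ ?_
  · intro κ hκ
    rw [mem_indices, Fin.sum_univ_castSucc] at hκ
    obtain ⟨h1, h2⟩ := hκ
    have h3 : r ≤ ∑ i : Fin r, κ i.castSucc := by
      simpa using Finset.card_nsmul_le_sum Finset.univ (fun i : Fin r => κ i.castSucc) 1
        (fun i _ => h2 _)
    have h4 := h2 (Fin.last r)
    simp only [Finset.mem_sigma, Finset.mem_range, mem_indices]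
    refine ⟨by omega, ?_, fun i => h2 _⟩
    show ∑ i : Fin r, κ i.castSucc = _
    omega
  · rintro ⟨l, κ⟩ hx
    simp only [Finset.mem_sigma, Finset.mem_range, mem_indices] at hx
    obtain ⟨h1, h2, h3⟩ := hx
    rw [mem_indices, Fin.sum_univ_castSucc]
    simp only [Fin.snoc_castSucc, Fin.snoc_last]
    refine ⟨by omega, fun i => ?_⟩
    induction i using Fin.lastCases with
    | last => simp
    | cast i => simpa using h3 i
  · intro κ hκ
    have := (mem_indices.1 hκ).2 (Fin.last r)
    simp [Nat.sub_add_cancel this]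
  · rintro ⟨q, n⟩ _; simp
  · intro κ hκ
    have := (mem_indices.1 hκ).2 (Fin.last r)
    simp [Nat.sub_add_cancel this]

/-- `2^r` times the sum of the unsigned nested sums over all indices of depth `r` and weight
`a + r`. -/
noncomputable def totalSum : ℕ → ℕ → ℕ → ℝ
  | 0, a, _ => if a = 0 then 1 else 0
  | r + 1, a, N => ∑ n ∈ Finset.range N, 2 * ∑ l ∈ Finset.range (a + 1),
      totalSum r (a - l) n / (2 * (n : ℝ) + 1 - r) ^ (l + 1)

/-- The part of `totalSum (r + 1) a` coming from chains with largest term `n + 1`. -/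
noncomputable def totalTerm (r a n : ℕ) : ℝ :=
  2 * ∑ l ∈ Finset.range (a + 1), totalSum r (a - l) n / (2 * (n : ℝ) + 1 - r) ^ (l + 1)

theorem totalSum_succ (r a N : ℕ) :
    totalSum (r + 1) a N = ∑ n ∈ Finset.range N, totalTerm r a n := rfl

/-- Peeling off the largest variable together with the last exponent `l + 1` reproduces the
recursion that defines `totalSum`. -/
theorem sum_nestedSum (r a N : ℕ) :
    2 ^ r * ∑ κ ∈ indices (a + r) r, nestedSum κ N = totalSum r a N := by
  induction r generalizing a N with
  | zero =>
    simp only [nestedSum_zero, totalSum, pow_zero, one_mul, Finset.sum_const, nsmul_eq_mul, mul_one]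
    rcases a with _ | a
    · have : indices 0 0 = {Fin.elim0} := by
        ext κ
        simp only [mem_indices, Finset.mem_singleton]
        exact ⟨fun _ => Subsingleton.elim _ _, fun _ => ⟨by simp, fun i => i.elim0⟩⟩
      simp [this]
    · have : indices (a + 1 + 0) 0 = ∅ := by
        ext κ
        simp [mem_indices]
      simp [this]
  | succ r ih =>
    rw [totalSum_succ, show a + (r + 1) = a + r + 1 from rfl, sum_indices_succ]
    simp only [nestedSum_succ, Fin.init_snoc, Fin.snoc_last, totalTerm, ← ih]
    rw [Finset.mul_sum]
    simp only [Finset.mul_sum, Finset.sum_div]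
    rw [Finset.sum_comm]
    refine Finset.sum_congr rfl fun l _ => ?_
    rw [Finset.sum_comm' (t' := Finset.range N) (s' := fun _ => indices (a - l + r) r)
      (by simp [and_comm])]
    refine Finset.sum_congr rfl fun n _ => Finset.sum_congr rfl fun κ _ => ?_
    ring

theorem sum_TBarPartial (r a N : ℕ) :
    ∑ κ ∈ indices (a + r + 1) (r + 1), TBarPartial κ N =
      ∑ n ∈ Finset.range N, (-1) ^ (n + 1) * totalTerm r a n := by
  rw [sum_indices_succ]
  simp only [TBarPartial_succ, Fin.init_snoc, Fin.snoc_last, totalTerm, ← sum_nestedSum]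
  simp only [Finset.mul_sum, Finset.sum_div]
  rw [Finset.sum_comm (s := Finset.range N)]
  refine Finset.sum_congr rfl fun l _ => ?_
  rw [Finset.sum_comm' (t' := Finset.range N) (s' := fun _ => indices (a - l + r) r)
    (by simp [and_comm])]
  refine Finset.sum_congr rfl fun n _ => Finset.sum_congr rfl fun κ _ => ?_
  ring

/-- Forces the terms with n < r to vanish. There the denominator 2n + 1 - r may be zero or negative;
for n ≥ r it is at least n + 1. -/
theorem le_of_mem_chains {r N : ℕ} {n : Fin r → ℕ} (hn : n ∈ chains r 1 N) : r ≤ N := by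
  induction r generalizing N with
  | zero => omega
  | succ r ih =>
    rw [← Fin.snoc_init_self n, mem_chains, strictMono_snoc_iff] at hn
    obtain ⟨h1, h2, h3⟩ := hn
    have hN := (h1 (Fin.last r)).2
    simp only [Fin.snoc_last] at hN
    have := ih (N := N - 1) (n := Fin.init n) (mem_chains.2
      ⟨fun i => ⟨by simpa using (h1 i.castSucc).1, by have := h3 i; omega⟩, h2⟩)
    by_cases hr : r = 0
    · have := (h1 (Fin.last r)).1
      simp only [Fin.snoc_last] at this
      omega
    · omega

theorem nestedSum_eq_zero {r N : ℕ} (κ : Fin r → ℕ) (h : N < r) : nestedSum κ N = 0 :=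
  Finset.sum_eq_zero fun _ hn => absurd (le_of_mem_chains hn) (not_le.2 h)

theorem totalSum_eq_zero {r a N : ℕ} (h : N < r) : totalSum r a N = 0 := by
  rw [← sum_nestedSum, Finset.sum_eq_zero fun κ _ => nestedSum_eq_zero κ h, mul_zero]

theorem totalTerm_eq_zero {r a n : ℕ} (h : n < r) : totalTerm r a n = 0 := by
  simp [totalTerm, totalSum_eq_zero h]

theorem totalTerm_zero_mul (r n : ℕ) :
    totalTerm r 0 n * (2 * (n : ℝ) + 1 - r) = 2 * totalSum r 0 n := by
  rcases lt_or_ge n r with h | h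
  · simp [totalTerm_eq_zero h, totalSum_eq_zero h]
  · have h' : (r : ℝ) ≤ n := by exact_mod_cast h
    have : 2 * (n : ℝ) + 1 - r ≠ 0 := by
      have : (0 : ℝ) ≤ n := n.cast_nonneg
      intro h0; linarith
    simp [totalTerm]
    field_simp

/-- Multiplying by the denominator isolates the summand `l = 0` and lowers every other exponent by
one. On generating series in exp(-(2n+1-r)t) this multiplication is -d/dt, so the identity becomes a
differential equation there. -/
theorem totalTerm_succ_mul (r a n : ℕ) :
    totalTerm r (a + 1) n * (2 * (n : ℝ) + 1 - r) =
      2 * totalSum r (a + 1) n + totalTerm r a n := by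
  rcases lt_or_ge n r with h | h
  · simp [totalTerm_eq_zero h, totalSum_eq_zero h]
  · have h' : (r : ℝ) ≤ n := by exact_mod_cast h
    have h0 : 2 * (n : ℝ) + 1 - r ≠ 0 := by
      have : (0 : ℝ) ≤ n := n.cast_nonneg
      intro h0; linarith
    rw [totalTerm, totalTerm, Finset.sum_range_succ', mul_assoc, add_mul, Finset.sum_mul, mul_add,
      add_comm]
    congr 1
    · simp
      field_simp
    · congr 1
      refine Finset.sum_congr rfl fun l _ => ?_
      rw [Nat.add_sub_add_right, pow_succ]
      field_simp

/-! ### Convergence of the defining series. -/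

/-- An alternating series whose terms tend to zero with bounded variation converges. -/
theorem exists_tendsto_alternating {b : ℕ → ℝ} (h0 : Tendsto b atTop (𝓝 0))
    (hb : Summable fun n => |b (n + 1) - b n|) :
    ∃ L, Tendsto (fun N => ∑ n ∈ Finset.range N, (-1) ^ n * b n) atTop (𝓝 L) := by
  -- Summation by parts: the remaining series has terms ±(b (n+1) - b n) and converges absolutely.
  have key : ∀ N, ∑ n ∈ Finset.range N, (-1) ^ n * b n =
      (b 0 - (-1) ^ N * b N - ∑ n ∈ Finset.range N, (-1) ^ n * (b (n + 1) - b n)) / 2 := by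
    intro N
    induction N with
    | zero => simp
    | succ N ih => rw [Finset.sum_range_succ, ih, Finset.sum_range_succ]; ring
  have hs : Summable fun n => (-1) ^ n * (b (n + 1) - b n) := by
    refine Summable.of_norm ?_
    simpa [abs_mul] using hb
  have h1 : Tendsto (fun N => (-1) ^ N * b N) atTop (𝓝 0) := by
    rw [tendsto_zero_iff_norm_tendsto_zero]
    simpa [abs_mul] using h0.abs
  exact ⟨_, (((tendsto_const_nhds.sub h1).sub hs.hasSum.tendsto_sum_nat).div_const 2).congr
    fun N => (key N).symm⟩

theorem nestedSum_nonneg {r : ℕ} (κ : Fin r → ℕ) (N : ℕ) : 0 ≤ nestedSum κ N := by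
  refine Finset.sum_nonneg fun n hn => Finset.prod_nonneg fun j _ => ?_
  have : ∀ j : Fin r, (j : ℕ) + 1 ≤ n j := by
    intro j
    obtain ⟨h1, h2⟩ := mem_chains.1 hn
    obtain ⟨j, hj⟩ := j
    induction j with
    | zero => exact (h1 _).1
    | succ j ih =>
      have h3 := ih (by omega)
      have h4 : n ⟨j, by omega⟩ < n ⟨j + 1, hj⟩ := h2 (by simp [Fin.lt_def])
      simp only at h3 ⊢
      omega
  have h : ((j : ℕ) : ℝ) + 1 ≤ n j := by exact_mod_cast this j
  have h' : (0 : ℝ) ≤ (j : ℕ) := Nat.cast_nonneg _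
  have : (0 : ℝ) ≤ 2 * (n j : ℝ) - ((j : ℕ) + 1) := by linarith
  positivity

theorem sum_inv_sqrt_le (N : ℕ) :
    ∑ n ∈ Finset.range N, 1 / √((n : ℝ) + 1) ≤ 2 * √(N : ℝ) := by
  induction N with
  | zero => simp
  | succ N ih =>
    rw [Finset.sum_range_succ]
    push_cast
    have h1 : (0 : ℝ) ≤ √(N : ℝ) := by positivity
    have h2 : (0 : ℝ) < √((N : ℝ) + 1) := by positivity
    have e1 := Real.sq_sqrt (show (0 : ℝ) ≤ (N : ℝ) by positivity)
    have e2 := Real.sq_sqrt (show (0 : ℝ) ≤ (N : ℝ) + 1 by positivity)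
    have h3 : 1 / √((N : ℝ) + 1) ≤ 2 * √((N : ℝ) + 1) - 2 * √(N : ℝ) := by
      rw [div_le_iff₀ h2]
      nlinarith [sq_nonneg (√((N : ℝ) + 1) - √(N : ℝ))]
    linarith

/-- The term of the series for `T̄` coming from chains with largest term `n + 1`, up to sign and
the power of `2`. -/
noncomputable def outerTerm {r : ℕ} (κ : Fin (r + 1) → ℕ) (n : ℕ) : ℝ :=
  nestedSum (Fin.init κ) n / (2 * (n : ℝ) + 1 - r) ^ κ (Fin.last r)

theorem outerTerm_nonneg {r : ℕ} (κ : Fin (r + 1) → ℕ) (n : ℕ) : 0 ≤ outerTerm κ n := by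
  rcases lt_or_ge n r with h | h
  · simp [outerTerm, nestedSum_eq_zero _ h]
  · have h' : (r : ℝ) ≤ n := by exact_mod_cast h
    have h0 : (0 : ℝ) ≤ n := n.cast_nonneg
    exact div_nonneg (nestedSum_nonneg _ _) (pow_nonneg (by linarith) _)

theorem outerTerm_le_of_nestedSum_le {r : ℕ} (κ : Fin (r + 1) → ℕ) (hκ : ∀ i, 1 ≤ κ i) {C : ℝ}
    (hC : 0 ≤ C) (h : ∀ N, nestedSum (Fin.init κ) N ≤ C * √((N : ℝ) + 1)) (n : ℕ) :
    outerTerm κ n ≤ C * (1 / √((n : ℝ) + 1)) := by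
  rcases lt_or_ge n r with hn | hn
  · simp only [outerTerm, nestedSum_eq_zero _ hn, zero_div]
    positivity
  · have h' : (r : ℝ) ≤ n := by exact_mod_cast hn
    have h0 : (0 : ℝ) ≤ n := n.cast_nonneg
    have h1 : (n : ℝ) + 1 ≤ (2 * (n : ℝ) + 1 - r) ^ κ (Fin.last r) :=
      (by linarith : (n : ℝ) + 1 ≤ 2 * (n : ℝ) + 1 - r).trans
        (le_self_pow₀ (by linarith) (by have := hκ (Fin.last r); omega))
    calc outerTerm κ n ≤ C * √((n : ℝ) + 1) / ((n : ℝ) + 1) :=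
          div_le_div₀ (by positivity) (h n) (by positivity) h1
      _ = _ := by
        have e2 := Real.sq_sqrt (show (0 : ℝ) ≤ (n : ℝ) + 1 by positivity)
        field_simp
        linear_combination C * e2

/-- The square root is a crude bound chosen because it reproduces itself in the recursion:
√(n+1)/(n+1) sums to at most 2√N. It still makes the outer terms tend to zero. -/
theorem nestedSum_le {r : ℕ} (κ : Fin r → ℕ) (hκ : ∀ i, 1 ≤ κ i) :
    ∃ C, 0 ≤ C ∧ ∀ N, nestedSum κ N ≤ C * √((N : ℝ) + 1) := by
  induction r with
  | zero =>
    refine ⟨1, zero_le_one, fun N => ?_⟩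
    rw [nestedSum_zero, one_mul]
    exact Real.one_le_sqrt.2 (by simp)
  | succ r ih =>
    obtain ⟨C, hC, h⟩ := ih (Fin.init κ) fun i => hκ _
    refine ⟨C * 2, by positivity, fun N => ?_⟩
    rw [nestedSum_succ]
    calc _ ≤ ∑ n ∈ Finset.range N, C * (1 / √((n : ℝ) + 1)) :=
          Finset.sum_le_sum fun n _ => outerTerm_le_of_nestedSum_le κ hκ hC h n
      _ ≤ C * (2 * √((N : ℝ) + 1)) := by
        rw [← Finset.mul_sum]
        refine mul_le_mul_of_nonneg_left ((sum_inv_sqrt_le N).trans ?_) hC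
        gcongr
        linarith
      _ = _ := by ring

theorem outerTerm_le {r : ℕ} (κ : Fin (r + 1) → ℕ) (hκ : ∀ i, 1 ≤ κ i) :
    ∃ C, 0 ≤ C ∧ ∀ n, outerTerm κ n ≤ C * (1 / √((n : ℝ) + 1)) := by
  obtain ⟨C, hC, h⟩ := nestedSum_le (Fin.init κ) fun i => hκ _
  exact ⟨C, hC, outerTerm_le_of_nestedSum_le κ hκ hC h⟩

theorem abs_nestedSum_sub_le {r : ℕ} (κ : Fin r → ℕ) (hκ : ∀ i, 1 ≤ κ i) :
    ∃ C, 0 ≤ C ∧ ∀ n, |nestedSum κ (n + 1) - nestedSum κ n| ≤ C * (1 / √((n : ℝ) + 1)) := by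
  cases r with
  | zero => exact ⟨0, le_rfl, fun n => by simp [nestedSum_zero]⟩
  | succ r =>
    obtain ⟨C, hC, h⟩ := outerTerm_le κ hκ
    refine ⟨C, hC, fun n => ?_⟩
    rw [nestedSum_succ, nestedSum_succ, Finset.sum_range_succ, add_sub_cancel_left]
    exact (abs_of_nonneg (outerTerm_nonneg κ n)).trans_le (h n)

theorem pow_sub_pow_le_mul_sub {a b : ℝ} (hb : 0 ≤ b) (hab : b ≤ a) (ha : a ≤ 1) (k : ℕ) :
    a ^ k - b ^ k ≤ k * (a - b) := by
  induction k with
  | zero => simp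
  | succ k ih =>
    have h1 : b ^ k ≤ a ^ k := pow_le_pow_left₀ hb hab k
    have h2 : b ^ k ≤ 1 := pow_le_one₀ hb (hab.trans ha)
    push_cast
    calc a ^ (k + 1) - b ^ (k + 1) = a * (a ^ k - b ^ k) + b ^ k * (a - b) := by ring
      _ ≤ 1 * (a ^ k - b ^ k) + 1 * (a - b) := by
        gcongr
      _ ≤ _ := by linarith

theorem summable_inv_mul_sqrt :
    Summable fun n : ℕ => 1 / (((n : ℝ) + 1) * √((n : ℝ) + 1)) := by
  have h := (summable_nat_add_iff 1).2
    (Real.summable_one_div_nat_rpow.2 (by norm_num : (1 : ℝ) < 3 / 2))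
  refine h.congr fun n => ?_
  push_cast
  rw [show (3 / 2 : ℝ) = 1 + 1 / 2 by norm_num, Real.rpow_add (by positivity), Real.rpow_one,
    Real.sqrt_eq_rpow]

/-- By the discrete product rule the difference has two parts: an increment O(n^(-1/2)) of the inner
sum times a factor O(1/n), and an inner sum O(n^(1/2)) times an increment O(n^(-2)). Both are
O(n^(-3/2)). -/
theorem summable_abs_outerTerm_sub {r : ℕ} (κ : Fin (r + 1) → ℕ) (hκ : ∀ i, 1 ≤ κ i) :
    Summable fun n => |outerTerm κ (n + 1) - outerTerm κ n| := by
  obtain ⟨C, hC, h⟩ := nestedSum_le (Fin.init κ) fun i => hκ _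
  obtain ⟨C', hC', h'⟩ := abs_nestedSum_sub_le (Fin.init κ) fun i => hκ _
  set k := κ (Fin.last r) with hk
  have hk1 : k ≠ 0 := by have := hκ (Fin.last r); omega
  refine Summable.of_norm_bounded_eventually_nat
    (g := fun n : ℕ => (C' + 2 * k * C) * (1 / (((n : ℝ) + 1) * √((n : ℝ) + 1))))
    (summable_inv_mul_sqrt.mul_left _) ?_
  filter_upwards [eventually_ge_atTop r] with n hn
  rw [Real.norm_eq_abs, abs_abs]
  have hn' : (r : ℝ) ≤ n := by exact_mod_cast hn
  have h0 : (0 : ℝ) ≤ n := n.cast_nonneg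
  set D : ℝ := 2 * (n : ℝ) + 1 - r with hD
  have hDn : (n : ℝ) + 1 ≤ D := by linarith
  have hD0 : 0 < D := by linarith
  have e1 : outerTerm κ (n + 1) - outerTerm κ n =
      (nestedSum (Fin.init κ) (n + 1) - nestedSum (Fin.init κ) n) * (1 / (D + 2)) ^ k
      + nestedSum (Fin.init κ) n * -((1 / D) ^ k - (1 / (D + 2)) ^ k) := by
    simp only [outerTerm, ← hk]
    push_cast
    rw [show 2 * ((n : ℝ) + 1) + 1 - r = D + 2 by rw [hD]; ring, ← hD, one_div_pow, one_div_pow]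
    ring
  have hle : 1 / (D + 2) ≤ 1 / D := one_div_le_one_div_of_le hD0 (by linarith)
  have hpos : 0 ≤ 1 / (D + 2) := by positivity
  have hD1 : 1 / D ≤ 1 := by rw [div_le_one hD0]; linarith
  have b1 : (1 / (D + 2)) ^ k ≤ 1 / ((n : ℝ) + 1) :=
    (pow_le_of_le_one hpos (hle.trans hD1) hk1).trans
      (one_div_le_one_div_of_le (by positivity) (by linarith))
  have b2 : (1 / D) ^ k - (1 / (D + 2)) ^ k ≤ k * (2 / ((n : ℝ) + 1) ^ 2) := by
    refine (pow_sub_pow_le_mul_sub hpos hle hD1 k).trans ?_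
    gcongr
    rw [div_sub_div _ _ hD0.ne' (by positivity)]
    refine div_le_div₀ (by norm_num) (by linarith) (by positivity) ?_
    nlinarith
  have b2' : 0 ≤ (1 / D) ^ k - (1 / (D + 2)) ^ k := sub_nonneg.2 (pow_le_pow_left₀ hpos hle k)
  have hs : √((n : ℝ) + 1) ^ 2 = (n : ℝ) + 1 := Real.sq_sqrt (by positivity)
  have hs0 : 0 < √((n : ℝ) + 1) := by positivity
  rw [e1]
  refine (abs_add_le _ _).trans ?_
  rw [abs_mul, abs_mul, abs_neg, abs_of_nonneg b2', abs_of_nonneg (pow_nonneg hpos k),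
    abs_of_nonneg (nestedSum_nonneg _ _)]
  calc _ ≤ C' * (1 / √((n : ℝ) + 1)) * (1 / ((n : ℝ) + 1)) +
        C * √((n : ℝ) + 1) * (k * (2 / ((n : ℝ) + 1) ^ 2)) := by
        gcongr
        · exact h' n
        · exact h n
    _ = _ := by
      field_simp
      rw [hs]
      ring

theorem exists_tendsto_TBarPartial {r : ℕ} (κ : Fin (r + 1) → ℕ) (hκ : ∀ i, 1 ≤ κ i) :
    ∃ L : ℝ, Tendsto (TBarPartial κ) atTop (𝓝 L) := by
  have h0 : Tendsto (outerTerm κ) atTop (𝓝 0) := by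
    obtain ⟨C, -, h⟩ := outerTerm_le κ hκ
    refine squeeze_zero (outerTerm_nonneg κ) h ?_
    rw [← mul_zero C]
    refine Tendsto.const_mul C ?_
    refine Tendsto.div_atTop tendsto_const_nhds (Real.tendsto_sqrt_atTop.comp ?_)
    exact tendsto_atTop_add_const_right _ _ tendsto_natCast_atTop_atTop
  obtain ⟨L, hL⟩ := exists_tendsto_alternating h0 (summable_abs_outerTerm_sub κ hκ)
  refine ⟨-2 ^ (r + 1) * L, (hL.const_mul (-2 ^ (r + 1))).congr fun N => ?_⟩
  rw [TBarPartial_succ, Finset.mul_sum, Finset.mul_sum]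
  refine Finset.sum_congr rfl fun n _ => ?_
  rw [outerTerm]
  ring

theorem tendsto_TBar {r : ℕ} (κ : Fin (r + 1) → ℕ) (hκ : ∀ i, 1 ≤ κ i) :
    Tendsto (TBarPartial κ) atTop (𝓝 (TBar κ)) :=
  tendsto_nhds_limUnder (exists_tendsto_TBarPartial κ hκ)

theorem exists_tendsto_zetaBarPartial {s : ℕ} (hs : 1 ≤ s) :
    ∃ L : ℝ, Tendsto (zetaBarPartial s) atTop (𝓝 L) := by
  have hanti : Antitone fun n : ℕ => 1 / ((n : ℝ) + 1) ^ s := by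
    intro a b hab
    have : (a : ℝ) ≤ b := by exact_mod_cast hab
    dsimp only
    gcongr
  have h0 : Tendsto (fun n : ℕ => 1 / ((n : ℝ) + 1) ^ s) atTop (𝓝 0) := by
    refine Tendsto.div_atTop tendsto_const_nhds ((tendsto_pow_atTop (by omega)).comp ?_)
    exact tendsto_atTop_add_const_right _ _ tendsto_natCast_atTop_atTop
  obtain ⟨L, hL⟩ := hanti.tendsto_alternating_series_of_tendsto_zero h0
  refine ⟨L, hL.congr fun N => ?_⟩
  rw [zetaBarPartial, sum_Icc_one_eq_sum_range]
  refine Finset.sum_congr rfl fun n _ => ?_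
  simp only [Nat.add_sub_cancel]
  push_cast
  ring

theorem tendsto_zetaBar {s : ℕ} (hs : 1 ≤ s) :
    Tendsto (zetaBarPartial s) atTop (𝓝 (zetaBar s)) := by
  rw [zetaBar, if_neg (by omega)]
  exact tendsto_nhds_limUnder (exists_tendsto_zetaBarPartial hs)

theorem tendsto_W (r a : ℕ) :
    Tendsto (fun N => ∑ n ∈ Finset.range N, (-1) ^ (n + 1) * totalTerm r a n) atTop
      (𝓝 (W (a + r + 1) (r + 1))) := by
  simp only [← sum_TBarPartial]
  exact tendsto_finsetSum _ fun κ hκ => tendsto_TBar κ (mem_indices.1 hκ).2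

/-! ### The numbers Z(j, p) as coefficients of sin(πx)/(πx). -/

/-- `∑ ∏ ζ̄(2 i_l - 2 i_{l-1})` over the chains `j = i₀ < ⋯ < i_k = p`. -/
noncomputable def zetaChainSum (k j p : ℕ) : ℝ :=
  ∑ i ∈ (chains (k + 1) j p).filter (fun i => i 0 = j ∧ i (Fin.last k) = p),
      ∏ l : Fin k, zetaBar (2 * i l.succ - 2 * i l.castSucc)

theorem zetaChainSum_zero (j p : ℕ) : zetaChainSum 0 j p = if j = p then 1 else 0 := by
  simp only [zetaChainSum, Finset.univ_eq_empty, Finset.prod_empty, Finset.sum_const, nsmul_eq_mul,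
    mul_one]
  split_ifs with h
  · subst h
    rw [Finset.card_eq_one.2 ⟨fun _ => j, ?_⟩, Nat.cast_one]
    ext i
    simp only [Finset.mem_filter, mem_chains, Finset.mem_singleton]
    constructor
    · rintro ⟨-, h, -⟩
      ext l
      rw [Subsingleton.elim (α := Fin 1) l 0, h]
    · rintro rfl
      exact ⟨⟨fun _ => ⟨le_rfl, le_rfl⟩, Subsingleton.strictMono (α := Fin 1) _⟩, rfl, rfl⟩
  · rw [Nat.cast_eq_zero, Finset.card_eq_zero]
    refine Finset.filter_eq_empty_iff.2 fun i _ hi => h ?_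
    rw [← hi.1, ← hi.2]
    rfl

theorem zetaChainSum_succ (k j p : ℕ) :
    zetaChainSum (k + 1) j p =
      ∑ q ∈ Finset.Ico j p, zetaChainSum k j q * zetaBar (2 * p - 2 * q) := by
  simp only [zetaChainSum, Finset.sum_mul]
  rw [Finset.sum_sigma']
  refine Finset.sum_bij' (fun n _ => ⟨n (Fin.last k).castSucc, Fin.init n⟩)
    (fun x _ => Fin.snoc x.2 p) ?_ ?_ ?_ ?_ ?_
  · intro n hn
    rw [Finset.mem_filter, mem_chains] at hn
    obtain ⟨⟨h1, h2⟩, h3, h4⟩ := hn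
    simp only [Finset.mem_sigma, Finset.mem_filter, Finset.mem_Ico, mem_chains]
    have h5 := h2 (Fin.castSucc_lt_last (Fin.last k))
    refine ⟨⟨(h1 _).1, by omega⟩,
      ⟨fun i => ⟨(h1 _).1, h2.monotone (Fin.castSucc_le_castSucc_iff.2 (Fin.le_last i))⟩,
        fun a b hab => h2 (Fin.castSucc_lt_castSucc_iff.2 hab)⟩, h3, rfl⟩
  · rintro ⟨q, n⟩ hx
    simp only [Finset.mem_sigma, Finset.mem_filter, Finset.mem_Ico, mem_chains] at hx
    obtain ⟨⟨h1, h2⟩, ⟨h3, h4⟩, h5, h6⟩ := hx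
    rw [Finset.mem_filter, mem_chains, strictMono_snoc_iff]
    refine ⟨⟨fun i => ?_, h4, fun i => (h3 i).2.trans_lt h2⟩, ?_, by simp⟩
    · induction i using Fin.lastCases with
      | last => simpa using (h1.trans h2.le)
      | cast i =>
        have := h3 i
        simp only [Fin.snoc_castSucc]
        omega
    · simpa [Fin.snoc, Fin.castLT] using h5
  · intro n hn
    rw [Finset.mem_filter] at hn
    simp [← hn.2.2]
  · rintro ⟨q, n⟩ hx
    simp only [Finset.mem_sigma, Finset.mem_filter] at hx
    simp [hx.2.2.2]
  · intro n hn
    rw [Finset.mem_filter] at hn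
    rw [Fin.prod_univ_castSucc, Fin.succ_last, hn.2.2]
    simp only [Fin.init, Fin.succ_castSucc]

theorem zetaChainSum_eq_zero {k j p : ℕ} (h : p - j < k) : zetaChainSum k j p = 0 := by
  induction k generalizing p with
  | zero => omega
  | succ k ih =>
    rw [zetaChainSum_succ]
    refine Finset.sum_eq_zero fun q hq => ?_
    rw [Finset.mem_Ico] at hq
    rw [ih (by omega), zero_mul]

/-- Longer chains do not exist, so the range of k may be extended freely; the empty chain k = 0
accounts for the separate case j = p. -/
theorem Z_eq_sum {j p K : ℕ} (h : p - j < K) :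
    Z j p = ∑ k ∈ Finset.range K, (-2) ^ k * zetaChainSum k j p := by
  obtain ⟨K, rfl⟩ : ∃ K', K = K' + 1 := ⟨K - 1, by omega⟩
  rw [Finset.sum_range_succ', zetaChainSum_zero, Z]
  split_ifs with hjp
  · subst hjp
    rw [Finset.sum_eq_zero]
    · simp
    · intro k _
      rw [zetaChainSum_eq_zero (by omega), mul_zero]
  · rw [← sum_Icc_one_eq_sum_range K (fun k => (-2) ^ k * zetaChainSum k j p)]
    simp only [mul_zero, add_zero]
    refine Finset.sum_subset (Finset.Icc_subset_Icc_right (by omega)) fun k hk hk' => ?_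
    rw [Finset.mem_Icc] at hk hk'
    change _ * zetaChainSum k j p = 0
    rw [zetaChainSum_eq_zero (by omega), mul_zero]

theorem Z_recursion {j p : ℕ} (h : j < p) :
    Z j p = -2 * ∑ q ∈ Finset.Ico j p, Z j q * zetaBar (2 * p - 2 * q) := by
  rw [Z_eq_sum (K := p - j + 1) (by omega), Finset.sum_range_succ', zetaChainSum_zero,
    if_neg h.ne, mul_zero, add_zero]
  simp only [zetaChainSum_succ, Finset.mul_sum]
  rw [Finset.sum_comm]
  refine Finset.sum_congr rfl fun q hq => ?_
  rw [Finset.mem_Ico] at hq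
  rw [Z_eq_sum (K := p - j) (by omega), Finset.sum_mul, Finset.mul_sum]
  refine Finset.sum_congr rfl fun k _ => ?_
  ring

/-- The value `B_k(1/2) / k!` of a Bernoulli polynomial. -/
noncomputable def bernoulliHalf (k : ℕ) : ℝ :=
  Polynomial.aeval (1 / 2 : ℝ) ((1 / k.factorial : ℚ) • Polynomial.bernoulli k)

/-- This is ∑ B_k(1/2)/k! X^k = X / (2 sinh(X/2)): the Bernoulli generating function at 1/2,
multiplied through by exp(-X/2). -/
theorem bernoulliHalf_mul_sinh :
    PowerSeries.mk bernoulliHalf *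
      (PowerSeries.rescale (1 / 2 : ℝ) (PowerSeries.exp ℝ) -
        PowerSeries.rescale (-1 / 2 : ℝ) (PowerSeries.exp ℝ)) = PowerSeries.X := by
  have h := Polynomial.bernoulli_generating_function (1 / 2 : ℝ)
  have e1 := PowerSeries.exp_mul_exp_eq_exp_add (A := ℝ) (1 / 2) (-1 / 2)
  have e2 := PowerSeries.exp_mul_exp_eq_exp_add (A := ℝ) 1 (-1 / 2)
  have e0 : PowerSeries.rescale (1 / 2 + -1 / 2 : ℝ) (PowerSeries.exp ℝ) = 1 := by
    norm_num [PowerSeries.rescale_zero]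
  rw [e0] at e1
  rw [show (1 + -1 / 2 : ℝ) = 1 / 2 by norm_num, PowerSeries.rescale_one, RingHom.id_apply] at e2
  calc _ = PowerSeries.mk bernoulliHalf * (PowerSeries.exp ℝ - 1) *
        PowerSeries.rescale (-1 / 2 : ℝ) (PowerSeries.exp ℝ) := by rw [← e2]; ring
    _ = PowerSeries.X * (PowerSeries.rescale (1 / 2 : ℝ) (PowerSeries.exp ℝ) *
        PowerSeries.rescale (-1 / 2 : ℝ) (PowerSeries.exp ℝ)) := by
      rw [← mul_assoc, ← h]; rfl
    _ = _ := by rw [e1, mul_one]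

theorem sum_range_two_mul (n : ℕ) (f : ℕ → ℝ) :
    ∑ i ∈ Finset.range (2 * n), f i = ∑ e ∈ Finset.range n, (f (2 * e) + f (2 * e + 1)) := by
  induction n with
  | zero => simp
  | succ n ih =>
    rw [mul_add, mul_one, Finset.sum_range_succ, Finset.sum_range_succ, ih, Finset.sum_range_succ,
      add_assoc]

/-- Compare coefficients of X^(2d+1). The difference of exponentials is odd, so only Bernoulli
values of even index survive; the factor 2^(2d) clears the halves. -/
theorem sum_bernoulliHalf {d : ℕ} (hd : 1 ≤ d) :
    ∑ e ∈ Finset.range (d + 1),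
      2 ^ (2 * e) * bernoulliHalf (2 * e) / (2 * (d - e) + 1).factorial = 0 := by
  have h := congrArg (PowerSeries.coeff (2 * d + 1)) bernoulliHalf_mul_sinh
  rw [PowerSeries.coeff_mul, Finset.Nat.sum_antidiagonal_eq_sum_range_succ_mk,
    PowerSeries.coeff_X, if_neg (by omega), show (2 * d + 1).succ = 2 * (d + 1) by omega,
    sum_range_two_mul] at h
  simp only [PowerSeries.coeff_mk, map_sub, PowerSeries.coeff_rescale, PowerSeries.coeff_exp] at h
  rw [← mul_zero ((2 : ℝ) ^ (2 * d)), ← h, Finset.mul_sum]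
  refine Finset.sum_congr rfl fun e he => ?_
  rw [Finset.mem_range] at he
  obtain ⟨f, rfl⟩ : ∃ f, d = e + f := ⟨d - e, by omega⟩
  rw [show 2 * (e + f) + 1 - 2 * e = 2 * f + 1 by omega,
    show 2 * (e + f) + 1 - (2 * e + 1) = 2 * f by omega, show e + f - e = f by omega]
  have h1 : (-1 / 2 : ℝ) ^ (2 * f) = (1 / 2) ^ (2 * f) := by
    rw [pow_mul, pow_mul]; norm_num
  have h2 : (2 : ℝ) ^ (2 * f) * (1 / 2) ^ (2 * f) = 1 := by
    rw [← mul_pow]; norm_num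
  rw [pow_succ, pow_succ, h1, mul_add 2 e f, pow_add]
  simp only [map_div₀, map_one, map_natCast, sub_self, mul_zero, add_zero]
  linear_combination -(2 ^ (2 * e) * bernoulliHalf (2 * e) / (2 * f + 1).factorial) * h2

/-- The Fourier series of the Bernoulli polynomial at 1/2, where cos(πn) = (-1)^n. The convention
ζ̄(0) = 1/2 makes the formula hold for k = 0 too. -/
theorem two_mul_zetaBar (k : ℕ) :
    2 * zetaBar (2 * k) = (-1) ^ k * Real.pi ^ (2 * k) * (2 ^ (2 * k) * bernoulliHalf (2 * k)) := by
  rcases Nat.eq_zero_or_pos k with rfl | hk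
  · simp [zetaBar, bernoulliHalf]
  · have h := (hasSum_one_div_nat_pow_mul_cos hk.ne' (x := 1 / 2) (by norm_num)).tendsto_sum_nat
    have h2 := (tendsto_zetaBar (s := 2 * k) (by omega))
    have h3 := h.comp (tendsto_add_atTop_nat 1)
    have h4 : ∀ N, ∑ n ∈ Finset.range (N + 1), 1 / (n : ℝ) ^ (2 * k) *
        Real.cos (2 * Real.pi * n * (1 / 2)) = -zetaBarPartial (2 * k) N := by
      intro N
      rw [Finset.sum_range_succ', zetaBarPartial, sum_Icc_one_eq_sum_range, ← Finset.sum_neg_distrib]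
      have : (2 * k) ≠ 0 := by omega
      simp only [Nat.cast_zero, zero_pow this, div_zero, zero_mul, add_zero, Nat.add_sub_cancel]
      refine Finset.sum_congr rfl fun n _ => ?_
      rw [show 2 * Real.pi * ((n + 1 : ℕ) : ℝ) * (1 / 2) = ((n + 1 : ℕ) : ℝ) * Real.pi by ring,
        Real.cos_nat_mul_pi, pow_succ]
      ring
    have h5 := tendsto_nhds_unique (h2.neg.congr fun N => (h4 N).symm) h3
    rw [neg_eq_iff_eq_neg] at h5
    rw [h5, bernoulliHalf, map_smul, Polynomial.eval_map_algebraMap, mul_pow, pow_succ,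
      Algebra.smul_def]
    simp only [map_div₀, map_one, map_natCast]
    ring

/-- The coefficients of `sin (π x) / (π x)` in powers of `x ^ 2`. -/
noncomputable def sincCoeff (d : ℕ) : ℝ := (-1) ^ d * Real.pi ^ (2 * d) / (2 * d + 1).factorial

/-- The coefficient of x^(2d) in (πx / sin πx) · (sin πx / πx) = 1. -/
theorem sum_zetaBar_sincCoeff {d : ℕ} (hd : 1 ≤ d) :
    ∑ e ∈ Finset.range (d + 1), 2 * zetaBar (2 * e) * sincCoeff (d - e) = 0 := by
  rw [← mul_zero ((-1) ^ d * Real.pi ^ (2 * d)), ← sum_bernoulliHalf hd, Finset.mul_sum]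
  refine Finset.sum_congr rfl fun e he => ?_
  rw [Finset.mem_range] at he
  obtain ⟨f, rfl⟩ : ∃ f, d = e + f := ⟨d - e, by omega⟩
  rw [two_mul_zetaBar, sincCoeff, show e + f - e = f by omega, mul_add 2 e f, pow_add, pow_add]
  ring

/-- Both sides satisfy the recursion inverting 2 ∑ ζ̄(2e) x^(2e), whose constant term is 1. In
particular Z(j, p) depends only on p - j. -/
theorem Z_eq_sincCoeff (j d : ℕ) : Z j (j + d) = sincCoeff d := by
  induction d using Nat.strong_induction_on with
  | _ d ih =>
    rcases Nat.eq_zero_or_pos d with rfl | hd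
    · simp [Z, sincCoeff]
    · rw [Z_recursion (by omega), Finset.sum_Ico_eq_sum_range, Nat.add_sub_cancel_left]
      have h := sum_zetaBar_sincCoeff hd
      rw [Finset.sum_range_succ', ← Finset.sum_range_reflect] at h
      have h1 : ∑ i ∈ Finset.range d, Z j (j + i) * zetaBar (2 * (j + d) - 2 * (j + i)) =
          ∑ i ∈ Finset.range d, zetaBar (2 * (d - 1 - i + 1)) * sincCoeff (d - (d - 1 - i + 1)) := by
        refine Finset.sum_congr rfl fun i hi => ?_
        rw [Finset.mem_range] at hi
        rw [ih i hi, show d - (d - 1 - i + 1) = i by omega,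
          show 2 * (j + d) - 2 * (j + i) = 2 * (d - 1 - i + 1) by omega, mul_comm]
      rw [h1]
      simp only [mul_assoc, ← Finset.mul_sum, mul_zero, Nat.sub_zero] at h
      have h0 : 2 * zetaBar 0 = 1 := by simp [zetaBar]
      linear_combination -h + sincCoeff d * h0

/-! ### The Gudermannian function and the integral representation of W. -/

open MeasureTheory Set

/-- The Gudermannian function. -/
noncomputable def gd (t : ℝ) : ℝ := Real.pi / 2 - 2 * Real.arctan (Real.exp (-t))

/-- The hyperbolic secant. -/
noncomputable def sech (t : ℝ) : ℝ := 1 / Real.cosh t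

theorem sech_eq (t : ℝ) : sech t = 2 * Real.exp (-t) / (1 + Real.exp (-(2 * t))) := by
  rw [sech, Real.cosh_eq]
  have h1 : Real.exp (-(2 * t)) = Real.exp (-t) * Real.exp (-t) := by
    rw [← Real.exp_add]; ring_nf
  have h2 : Real.exp t * Real.exp (-t) = 1 := by rw [← Real.exp_add]; simp
  have := Real.exp_pos t
  have := Real.exp_pos (-t)
  rw [h1, div_eq_div_iff (by positivity) (by positivity)]
  linear_combination -h2

theorem sech_pos (t : ℝ) : 0 < sech t := one_div_pos.2 (Real.cosh_pos t)

theorem sech_le_one (t : ℝ) : sech t ≤ 1 := by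
  rw [sech, div_le_one (Real.cosh_pos t)]
  exact Real.one_le_cosh t

theorem sech_le (t : ℝ) : sech t ≤ 2 * Real.exp (-t) := by
  rw [sech_eq]
  have := Real.exp_pos (-(2 * t))
  exact div_le_self (by positivity) (by linarith)

theorem continuous_sech : Continuous sech :=
  continuous_const.div Real.continuous_cosh fun t => (Real.cosh_pos t).ne'

theorem continuous_gd : Continuous gd := by
  unfold gd
  fun_prop

theorem hasDerivAt_gd (t : ℝ) : HasDerivAt gd (sech t) t := by
  have h1 : HasDerivAt (fun t : ℝ => Real.exp (-t)) (-Real.exp (-t)) t := by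
    simpa using (hasDerivAt_neg t).exp
  have h := ((h1.arctan).const_mul 2).const_sub (Real.pi / 2)
  refine HasDerivAt.congr_deriv (f := gd) h ?_
  rw [sech_eq]
  have h1 : Real.exp (-(2 * t)) = Real.exp (-t) ^ 2 := by
    rw [← Real.exp_nat_mul]; push_cast; ring_nf
  rw [h1]
  ring

theorem gd_zero : gd 0 = 0 := by
  simp only [gd, neg_zero, Real.exp_zero, Real.arctan_one]
  ring

theorem gd_strictMono : StrictMono gd := fun s t h => by
  have : Real.arctan (Real.exp (-t)) < Real.arctan (Real.exp (-s)) :=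
    Real.arctan_strictMono (Real.exp_strictMono (neg_lt_neg h))
  simp only [gd]
  linarith

theorem gd_nonneg {t : ℝ} (h : 0 ≤ t) : 0 ≤ gd t := gd_zero ▸ gd_strictMono.monotone h

theorem gd_lt_pi_div_two (t : ℝ) : gd t < Real.pi / 2 := by
  have : 0 < Real.arctan (Real.exp (-t)) := Real.arctan_pos.2 (Real.exp_pos _)
  simp only [gd]
  linarith

theorem tendsto_gd_atTop : Tendsto gd atTop (𝓝 (Real.pi / 2)) := by
  have h := ((Real.continuous_arctan.tendsto 0).comp
    (Real.tendsto_exp_neg_atTop_nhds_zero)).const_mul 2 |>.const_sub (Real.pi / 2)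
  have hgd : gd = fun t => Real.pi / 2 - 2 * Real.arctan (Real.exp (-t)) := rfl
  rw [hgd]
  simpa [Function.comp_def] using h

/-- The normalised power `x ^ a / a!`. -/
noncomputable def dpow (a : ℕ) (x : ℝ) : ℝ := x ^ a / a.factorial

theorem continuous_dpow (a : ℕ) : Continuous (dpow a) := by
  unfold dpow
  fun_prop

theorem dpow_nonneg (a : ℕ) {x : ℝ} (hx : 0 ≤ x) : 0 ≤ dpow a x := by
  unfold dpow
  positivity

theorem dpow_le_dpow (a : ℕ) {x y : ℝ} (hx : 0 ≤ x) (hxy : x ≤ y) : dpow a x ≤ dpow a y := by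
  unfold dpow
  gcongr

theorem dpow_zero (x : ℝ) : dpow 0 x = 1 := by simp [dpow]

/-- Polynomial growth costs only half of the decay e^(-x) of sech, leaving an integrable e^(-x/2).
-/
theorem dpow_le_exp (a : ℕ) {x : ℝ} (hx : 0 ≤ x) : dpow a x ≤ 2 ^ a * Real.exp (x / 2) := by
  have h := Real.pow_div_factorial_le_exp (x / 2) (by positivity) a
  calc dpow a x = 2 ^ a * ((x / 2) ^ a / a.factorial) := by
        rw [dpow, div_pow]
        field_simp
    _ ≤ _ := by gcongr

/-- The derivative of `dpow a`. -/
noncomputable def dpowDeriv : ℕ → ℝ → ℝ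
  | 0, _ => 0
  | a + 1, x => dpow a x

theorem continuous_dpowDeriv (a : ℕ) : Continuous (dpowDeriv a) := by
  cases a with
  | zero => exact continuous_const
  | succ a => exact continuous_dpow a

theorem hasDerivAt_dpow (a : ℕ) (x : ℝ) : HasDerivAt (dpow a) (dpowDeriv a x) x := by
  cases a with
  | zero =>
    have : dpow 0 = fun _ => 1 := funext dpow_zero
    rw [this]
    exact hasDerivAt_const x 1
  | succ a =>
    have h := (hasDerivAt_pow (a + 1) x).div_const ((a + 1).factorial : ℝ)
    refine h.congr_deriv ?_
    rw [dpowDeriv, dpow, Nat.factorial_succ]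
    push_cast
    have : (a.factorial : ℝ) ≠ 0 := by positivity
    have : (a : ℝ) + 1 ≠ 0 := by positivity
    field_simp

/-- `∫_{T > t} (T - t)^a / a! (gd T - gd t)^b / b! sech T dT`. -/
noncomputable def gdMoment (a b : ℕ) (t : ℝ) : ℝ :=
  ∫ T in Ioi t, dpow a (T - t) * dpow b (gd T - gd t) * sech T

theorem integrableOn_exp_neg_mul_Ioi {c : ℝ} (hc : 0 < c) (t : ℝ) :
    IntegrableOn (fun T => Real.exp (-(c * T))) (Ioi t) := by
  simpa using integrableOn_exp_mul_Ioi (a := -c) (by linarith) t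

theorem dpow_mul_dpow_gd_le (a b : ℕ) {s T : ℝ} (hs : 0 ≤ s) (hT : s ≤ T) :
    dpow a (T - s) * dpow b (gd T - gd s) ≤
      2 ^ a * dpow b (Real.pi / 2) * Real.exp (T / 2) := by
  have h1 : dpow a (T - s) ≤ 2 ^ a * Real.exp (T / 2) :=
    (dpow_le_dpow a (by linarith) (by linarith)).trans (dpow_le_exp a (hs.trans hT))
  have h2 : 0 ≤ gd T - gd s := sub_nonneg.2 (gd_strictMono.monotone hT)
  have h3 : dpow b (gd T - gd s) ≤ dpow b (Real.pi / 2) :=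
    dpow_le_dpow b h2 (by linarith [gd_nonneg hs, gd_lt_pi_div_two T])
  calc _ ≤ (2 ^ a * Real.exp (T / 2)) * dpow b (Real.pi / 2) :=
        mul_le_mul h1 h3 (dpow_nonneg b h2) (by positivity)
    _ = _ := by ring

theorem dpow_mul_dpow_gd_nonneg (a b : ℕ) {s T : ℝ} (hT : s ≤ T) :
    0 ≤ dpow a (T - s) * dpow b (gd T - gd s) :=
  mul_nonneg (dpow_nonneg a (by linarith))
    (dpow_nonneg b (sub_nonneg.2 (gd_strictMono.monotone hT)))

theorem integrableOn_mul_sech {f : ℝ → ℝ} (hf : Continuous f) {C t : ℝ}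
    (h : ∀ T, t < T → |f T| ≤ C * Real.exp (T / 2)) :
    IntegrableOn (fun T => f T * sech T) (Ioi t) := by
  refine Integrable.mono' (g := fun T => 2 * C * Real.exp (-(1 / 2 * T)))
    ((integrableOn_exp_neg_mul_Ioi (by norm_num) t).const_mul _)
    (hf.mul continuous_sech).aestronglyMeasurable ?_
  refine (ae_restrict_iff' measurableSet_Ioi).2 (Eventually.of_forall fun T hT => ?_)
  rw [Real.norm_eq_abs, abs_mul, abs_of_pos (sech_pos T)]
  calc _ ≤ C * Real.exp (T / 2) * (2 * Real.exp (-T)) :=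
        mul_le_mul (h T hT) (sech_le T) (sech_pos T).le ((abs_nonneg _).trans (h T hT))
    _ = _ := by
      rw [show -(1 / 2 * T) = T / 2 + -T by ring, Real.exp_add]
      ring

theorem integrableOn_gdMoment (a b : ℕ) {t : ℝ} (ht : 0 ≤ t) :
    IntegrableOn (fun T => dpow a (T - t) * dpow b (gd T - gd t) * sech T) (Ioi t) := by
  refine integrableOn_mul_sech (C := 2 ^ a * dpow b (Real.pi / 2)) ?_ fun T hT => ?_
  · have := continuous_dpow a
    have := continuous_dpow b
    have := continuous_gd
    fun_prop
  · rw [abs_of_nonneg (dpow_mul_dpow_gd_nonneg a b (le_of_lt hT))]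
    exact dpow_mul_dpow_gd_le a b ht (le_of_lt hT)

theorem integral_Ioi_swap {K : ℝ → ℝ → ℝ} (hK : Continuous (Function.uncurry K)) {C t : ℝ}
    (hb : ∀ s T, t < s → s < T → |K s T| ≤ C * Real.exp (T / 2)) :
    ∫ s in Ioi t, ∫ T in Ioi s, K s T * sech T =
      ∫ T in Ioi t, (∫ s in t..T, K s T) * sech T := by
  set F : ℝ × ℝ → ℝ := {p : ℝ × ℝ | p.1 < p.2}.indicator
    (fun p => K p.1 p.2 * sech p.2) with hF
  have hmeas : MeasurableSet {p : ℝ × ℝ | p.1 < p.2} := measurableSet_lt measurable_fst measurable_snd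
  have hC : 0 ≤ C := by
    have := (abs_nonneg _).trans (hb (t + 1) (t + 2) (by linarith) (by linarith))
    exact nonneg_of_mul_nonneg_left this (Real.exp_pos _)
  have hint : Integrable F ((volume.restrict (Ioi t)).prod (volume.restrict (Ioi t))) := by
    -- On s < T the bound e^(-T/2) is at most e^(-s/4) e^(-T/4), a product integrable on the
    -- quadrant; this justifies Fubini.
    have hg : Integrable (fun T => Real.exp (-(1 / 4 * T))) (volume.restrict (Ioi t)) :=
      integrableOn_exp_neg_mul_Ioi (by norm_num) t
    refine Integrable.mono' ((hg.mul_prod hg).const_mul (2 * C)) ?_ ?_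
    · refine AEStronglyMeasurable.indicator ?_ hmeas
      exact ((hK.mul (continuous_sech.comp continuous_snd))).aestronglyMeasurable
    · rw [Measure.prod_restrict, ae_restrict_iff' (measurableSet_Ioi.prod measurableSet_Ioi)]
      refine Eventually.of_forall fun p hp => ?_
      obtain ⟨hp1, hp2⟩ := hp
      simp only [mem_Ioi] at hp1 hp2
      by_cases h : p.1 < p.2
      · rw [hF, indicator_of_mem (show p ∈ {p : ℝ × ℝ | p.1 < p.2} from h), Real.norm_eq_abs,
          abs_mul, abs_of_pos (sech_pos _)]
        have h1 := hb p.1 p.2 hp1 h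
        calc _ ≤ C * Real.exp (p.2 / 2) * (2 * Real.exp (-p.2)) :=
              mul_le_mul h1 (sech_le _) (sech_pos _).le ((abs_nonneg _).trans h1)
          _ = 2 * C * Real.exp (-(1 / 2 * p.2)) := by
            rw [show -(1 / 2 * p.2) = p.2 / 2 + -p.2 by ring, Real.exp_add]
            ring
          _ ≤ 2 * C * Real.exp (-(1 / 4 * p.1) + -(1 / 4 * p.2)) := by
            gcongr
            linarith
          _ = _ := by rw [Real.exp_add]
      · rw [hF, indicator_of_notMem (show p ∉ {p : ℝ × ℝ | p.1 < p.2} from h), norm_zero]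
        positivity
  have hswap := integral_integral_swap (f := fun s T => F (s, T)) hint
  have h1 : ∫ s in Ioi t, ∫ T in Ioi t, F (s, T) = ∫ s in Ioi t, ∫ T in Ioi s, K s T * sech T := by
    refine setIntegral_congr_fun measurableSet_Ioi fun s hs => ?_
    have : (fun T => F (s, T)) = (Ioi s).indicator fun T => K s T * sech T := by
      ext T
      simp [hF, indicator]
    simp only [this]
    rw [setIntegral_indicator measurableSet_Ioi, inter_eq_right.2 (Ioi_subset_Ioi (le_of_lt hs))]
  have h2 : ∫ T in Ioi t, ∫ s in Ioi t, F (s, T) =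
      ∫ T in Ioi t, (∫ s in t..T, K s T) * sech T := by
    refine setIntegral_congr_fun measurableSet_Ioi fun T hT => ?_
    have : (fun s => F (s, T)) = (Iio T).indicator fun s => K s T * sech T := by
      ext s
      simp [hF, indicator]
    simp only [this]
    rw [setIntegral_indicator measurableSet_Iio, Ioi_inter_Iio, integral_mul_const,
      intervalIntegral.integral_of_le (le_of_lt hT), integral_Ioc_eq_integral_Ioo]
  rw [← h1, ← h2, hswap]

theorem dpow_self_zero {a : ℕ} (ha : a ≠ 0) : dpow a 0 = 0 := by
  simp [dpow, ha]

/-- The integrated form of the differential equation for `gdMoment`. -/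
theorem gdMoment_eq {a b : ℕ} (hab : a ≠ 0 ∨ b ≠ 0) {t : ℝ} (ht : 0 ≤ t) :
    gdMoment a b t = ∫ s in Ioi t, ∫ T in Ioi s,
      (dpowDeriv a (T - s) * dpow b (gd T - gd s) +
        sech s * (dpow a (T - s) * dpowDeriv b (gd T - gd s))) * sech T := by
  have c1 := continuous_dpow a
  have c2 := continuous_dpow b
  have c3 := continuous_dpowDeriv a
  have c4 := continuous_dpowDeriv b
  have c5 := continuous_gd
  have c6 := continuous_sech
  obtain ⟨C, hC⟩ : ∃ C, ∀ s T, t < s → s < T →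
      |dpowDeriv a (T - s) * dpow b (gd T - gd s) +
        sech s * (dpow a (T - s) * dpowDeriv b (gd T - gd s))| ≤ C * Real.exp (T / 2) := by
    have A : ∃ C, ∀ s T, t < s → s < T →
        |dpowDeriv a (T - s) * dpow b (gd T - gd s)| ≤ C * Real.exp (T / 2) := by
      cases a with
      | zero => exact ⟨0, fun s T _ _ => by simp [dpowDeriv]⟩
      | succ a =>
        refine ⟨2 ^ a * dpow b (Real.pi / 2), fun s T hs hT => ?_⟩
        rw [dpowDeriv, abs_of_nonneg (dpow_mul_dpow_gd_nonneg a b hT.le)]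
        exact dpow_mul_dpow_gd_le a b (ht.trans hs.le) hT.le
    have B : ∃ C, ∀ s T, t < s → s < T →
        |sech s * (dpow a (T - s) * dpowDeriv b (gd T - gd s))| ≤ C * Real.exp (T / 2) := by
      cases b with
      | zero => exact ⟨0, fun s T _ _ => by simp [dpowDeriv]⟩
      | succ b =>
        refine ⟨2 ^ a * dpow b (Real.pi / 2), fun s T hs hT => ?_⟩
        have h0 := dpow_mul_dpow_gd_nonneg a b hT.le
        rw [dpowDeriv, abs_mul, abs_of_pos (sech_pos s), abs_of_nonneg h0]
        exact (mul_le_of_le_one_left h0 (sech_le_one s)).trans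
          (dpow_mul_dpow_gd_le a b (ht.trans hs.le) hT.le)
    obtain ⟨C, hC⟩ := A
    obtain ⟨C', hC'⟩ := B
    refine ⟨C + C', fun s T hs hT => (abs_add_le _ _).trans ?_⟩
    rw [add_mul]
    exact add_le_add (hC s T hs hT) (hC' s T hs hT)
  rw [integral_Ioi_swap (K := fun s T => dpowDeriv a (T - s) * dpow b (gd T - gd s) +
        sech s * (dpow a (T - s) * dpowDeriv b (gd T - gd s))) (by unfold Function.uncurry; fun_prop)
        hC, gdMoment]
  refine setIntegral_congr_fun measurableSet_Ioi fun T _ => ?_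
  congr 1
  have hd : ∀ s ∈ uIcc t T, HasDerivAt (fun s => -(dpow a (T - s) * dpow b (gd T - gd s)))
      (dpowDeriv a (T - s) * dpow b (gd T - gd s) +
        sech s * (dpow a (T - s) * dpowDeriv b (gd T - gd s))) s := by
    intro s _
    have h1 := (hasDerivAt_dpow a (T - s)).comp s ((hasDerivAt_id s).const_sub T)
    have h2 := (hasDerivAt_dpow b (gd T - gd s)).comp s ((hasDerivAt_gd s).const_sub (gd T))
    refine (h1.mul h2).neg.congr_deriv ?_
    simp only [Function.comp]
    ring
  rw [intervalIntegral.integral_eq_sub_of_hasDerivAt hd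
    (Continuous.intervalIntegrable (by fun_prop) _ _)]
  -- The boundary term at s = T vanishes unless a = b = 0, which `hab` excludes.
  have h0 : dpow a (T - T) * dpow b (gd T - gd T) = 0 := by
    rcases hab with h | h <;> simp [dpow_self_zero h]
  rw [h0]
  ring

theorem gdMoment_zero_zero (t : ℝ) : gdMoment 0 0 t = ∫ s in Ioi t, sech s := by
  simp [gdMoment, dpow_zero]

theorem gdMoment_succ_zero (a : ℕ) {t : ℝ} (ht : 0 ≤ t) :
    gdMoment (a + 1) 0 t = ∫ s in Ioi t, gdMoment a 0 s := by
  rw [gdMoment_eq (by simp) ht]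
  simp [dpowDeriv, gdMoment]

theorem gdMoment_zero_succ (b : ℕ) {t : ℝ} (ht : 0 ≤ t) :
    gdMoment 0 (b + 1) t = ∫ s in Ioi t, sech s * gdMoment 0 b s := by
  rw [gdMoment_eq (by simp) ht]
  simp only [dpowDeriv, gdMoment, ← integral_const_mul, zero_mul, zero_add, mul_assoc]

theorem gdMoment_succ_succ (a b : ℕ) {t : ℝ} (ht : 0 ≤ t) :
    gdMoment (a + 1) (b + 1) t =
      ∫ s in Ioi t, (sech s * gdMoment (a + 1) b s + gdMoment a (b + 1) s) := by
  rw [gdMoment_eq (by simp) ht]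
  refine setIntegral_congr_fun measurableSet_Ioi fun s hs => ?_
  have hs0 : 0 ≤ s := ht.trans (le_of_lt hs)
  simp only [dpowDeriv, gdMoment, add_mul]
  rw [integral_add (integrableOn_gdMoment a (b + 1) hs0), add_comm, ← integral_const_mul]
  · simp only [mul_assoc]
  · simpa only [mul_assoc] using (integrableOn_gdMoment (a + 1) b hs0).const_mul (sech s)

theorem integral_exp_neg_mul_Ioi {m : ℝ} (hm : 0 < m) (t : ℝ) :
    ∫ T in Ioi t, Real.exp (-(m * T)) = Real.exp (-(m * t)) / m := by
  have h := integral_exp_mul_Ioi (a := -m) (by linarith) t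
  simp only [neg_mul] at h
  rw [h]
  field_simp

/-- Termwise integration over `(t, ∞)` of a series of exponentials. -/
theorem hasSum_integral_exp {r : ℕ} {c : ℕ → ℝ} (hc : ∀ n < r, c n = 0) {Φ : ℝ → ℝ}
    (h : ∀ T : ℝ, 0 < T → HasSum (fun n : ℕ => c n * (2 * (n : ℝ) + 1 - r) *
      Real.exp (-((2 * (n : ℝ) + 1 - r) * T))) (Φ T)) {t : ℝ} (ht : 0 < t) :
    HasSum (fun n : ℕ => c n * Real.exp (-((2 * (n : ℝ) + 1 - r) * t))) (∫ T in Ioi t, Φ T) := by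
  have hm : ∀ n : ℕ, r ≤ n → 1 ≤ 2 * (n : ℝ) + 1 - r := fun n hn => by
    have h1 : (r : ℝ) ≤ n := by exact_mod_cast hn
    have h0 : (0 : ℝ) ≤ n := n.cast_nonneg
    linarith
  have hint : ∀ n : ℕ, IntegrableOn (fun T => c n * (2 * (n : ℝ) + 1 - r) *
      Real.exp (-((2 * (n : ℝ) + 1 - r) * T))) (Ioi t) := by
    intro n
    rcases lt_or_ge n r with hn | hn
    · simp [hc n hn]
    · exact (integrableOn_exp_neg_mul_Ioi (by linarith [hm n hn]) t).const_mul _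
  have hval : ∀ n : ℕ, ∫ T in Ioi t, c n * (2 * (n : ℝ) + 1 - r) *
      Real.exp (-((2 * (n : ℝ) + 1 - r) * T)) =
      c n * Real.exp (-((2 * (n : ℝ) + 1 - r) * t)) := by
    intro n
    rcases lt_or_ge n r with hn | hn
    · simp [hc n hn]
    · have := hm n hn
      rw [integral_const_mul, integral_exp_neg_mul_Ioi (by linarith)]
      have : 2 * (n : ℝ) + 1 - r ≠ 0 := by linarith
      field_simp
  have hnorm : ∀ n : ℕ, ∫ T in Ioi t, ‖c n * (2 * (n : ℝ) + 1 - r) *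
      Real.exp (-((2 * (n : ℝ) + 1 - r) * T))‖ =
      |c n| * Real.exp (-((2 * (n : ℝ) + 1 - r) * t)) := by
    intro n
    rcases lt_or_ge n r with hn | hn
    · simp [hc n hn]
    · have := hm n hn
      simp only [norm_mul, Real.norm_eq_abs, Real.abs_exp]
      rw [integral_const_mul, integral_exp_neg_mul_Ioi (by linarith),
        abs_of_pos (by linarith : 0 < 2 * (n : ℝ) + 1 - r)]
      have : 2 * (n : ℝ) + 1 - r ≠ 0 := by linarith
      field_simp
  -- Since 2n + 1 - r ≥ 1 for n ≥ r, the integrated norms are dominated by the norms of the given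
  -- series at the endpoint t.
  have hs := hasSum_integral_of_summable_integral_norm hint (by
    simp only [hnorm]
    refine Summable.of_nonneg_of_le (fun n => by positivity) (fun n => ?_) (h t ht).summable.norm
    rcases lt_or_ge n r with hn | hn
    · simp [hc n hn]
    · have := hm n hn
      rw [norm_mul, norm_mul, Real.norm_eq_abs, Real.norm_eq_abs, Real.norm_eq_abs, Real.abs_exp,
        abs_of_pos (by linarith : 0 < 2 * (n : ℝ) + 1 - r)]
      gcongr
      exact le_mul_of_one_le_right (abs_nonneg _) this)
  simp only [hval] at hs
  convert! hs using 1
  refine setIntegral_congr_fun measurableSet_Ioi fun T hT => ?_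
  exact (h T (ht.trans hT)).tsum_eq.symm

theorem hasSum_alternating_exp {T : ℝ} (hT : 0 < T) :
    HasSum (fun n : ℕ => (-1 : ℝ) ^ n * Real.exp (-(2 * n * T))) (1 / (1 + Real.exp (-(2 * T)))) := by
  have h := hasSum_geometric_of_norm_lt_one (ξ := -Real.exp (-(2 * T))) (by
    rw [norm_neg, Real.norm_eq_abs, Real.abs_exp, Real.exp_lt_one_iff]
    linarith)
  rw [sub_neg_eq_add, ← one_div] at h
  refine h.congr_fun fun n => ?_
  rw [neg_pow (Real.exp _), ← Real.exp_nat_mul]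
  ring_nf

theorem hasSum_sech {T : ℝ} (hT : 0 < T) :
    HasSum (fun n : ℕ => (-1 : ℝ) ^ n * 2 * Real.exp (-((2 * n + 1) * T))) (sech T) := by
  have h := (hasSum_alternating_exp hT).mul_left (2 * Real.exp (-T))
  rw [mul_one_div, ← sech_eq] at h
  refine h.congr_fun fun n => ?_
  rw [show -((2 * (n : ℝ) + 1) * T) = -T + -(2 * n * T) by ring, Real.exp_add]
  ring

/-- Passing from the terms of a nested sum to its partial sums multiplies the generating series by
`-sech`. -/
theorem hasSum_totalSum_succ {r a : ℕ} {T P : ℝ} (hT : 0 < T)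
    (h : HasSum (fun n : ℕ => (-1) ^ n * totalTerm r a n *
      Real.exp (-((2 * (n : ℝ) + 1 - r) * T))) P) :
    HasSum (fun n : ℕ => (-1) ^ n * (2 * totalSum (r + 1) a n) *
      Real.exp (-((2 * (n : ℝ) + 1 - (r + 1 : ℕ)) * T))) (-(sech T * P)) := by
  have hg := hasSum_alternating_exp hT
  -- Partial sums arise from the Cauchy product with 1/(1 + e^(-2T)). The index shift by one and the
  -- replacement of r by r + 1 produce the factor -e^(-T), completing -sech T.
  have hp := (hasSum_sum_range_mul_of_summable_norm h.summable.norm hg.summable.norm).mul_left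
    (-(2 * Real.exp (-T)))
  rw [h.tsum_eq, hg.tsum_eq] at hp
  have h0 : (-1 : ℝ) ^ 0 * (2 * totalSum (r + 1) a 0) *
      Real.exp (-((2 * ((0 : ℕ) : ℝ) + 1 - (r + 1 : ℕ)) * T)) = 0 := by
    simp [totalSum_succ]
  rw [← hasSum_nat_add_iff' 1, Finset.sum_range_one, h0, sub_zero]
  have hv : -(2 * Real.exp (-T)) * (P * (1 / (1 + Real.exp (-(2 * T))))) = -(sech T * P) := by
    rw [sech_eq]
    ring
  rw [hv] at hp
  refine hp.congr_fun fun n => ?_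
  rw [totalSum_succ, Finset.mul_sum, Finset.mul_sum, Finset.mul_sum, Finset.sum_mul]
  refine Finset.sum_congr rfl fun i hi => ?_
  have hi' : i ≤ n := by
    rw [Finset.mem_range] at hi
    omega
  obtain ⟨l, rfl⟩ := Nat.exists_eq_add_of_le hi'
  rw [Nat.add_sub_cancel_left]
  push_cast
  rw [show -((2 * ((i : ℝ) + l + 1) + 1 - (r + 1)) * T) =
    -T + (-((2 * (i : ℝ) + 1 - r) * T) + -(2 * l * T)) by ring, Real.exp_add, Real.exp_add]
  ring

/-- Double induction on r and a. The recursions of `totalTerm` match those of `gdMoment`: dividing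
by 2n + 1 - r is integration over (t, ∞), and passing to partial sums is multiplication by -sech. -/
theorem hasSum_totalTerm (r a : ℕ) {t : ℝ} (ht : 0 < t) :
    HasSum (fun n : ℕ => (-1) ^ n * totalTerm r a n *
      Real.exp (-((2 * (n : ℝ) + 1 - r) * t))) ((-1) ^ r * gdMoment a r t) := by
  have hz : ∀ r a, ∀ n < r, (-1 : ℝ) ^ n * totalTerm r a n = 0 := fun r a n hn => by
    rw [totalTerm_eq_zero hn, mul_zero]
  induction r generalizing a t with
  | zero =>
    induction a generalizing t with
    | zero =>
      rw [gdMoment_zero_zero, pow_zero, one_mul]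
      refine hasSum_integral_exp (hz 0 0) (fun T hT => ?_) ht
      refine (hasSum_sech hT).congr_fun fun n => ?_
      rw [mul_assoc ((-1) ^ n), totalTerm_zero_mul]
      simp [totalSum]
    | succ a ih =>
      rw [gdMoment_succ_zero a ht.le, pow_zero, one_mul]
      refine hasSum_integral_exp (hz 0 (a + 1)) (fun T hT => ?_) ht
      have h := ih hT
      rw [pow_zero, one_mul] at h
      refine h.congr_fun fun n => ?_
      rw [mul_assoc ((-1) ^ n), totalTerm_succ_mul]
      simp [totalSum]
  | succ r ihr =>
    have hB : ∀ a T, 0 < T → HasSum (fun n : ℕ => (-1) ^ n * (2 * totalSum (r + 1) a n) *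
        Real.exp (-((2 * (n : ℝ) + 1 - (r + 1 : ℕ)) * T)))
        ((-1) ^ (r + 1) * (sech T * gdMoment a r T)) := by
      intro a T hT
      convert! hasSum_totalSum_succ hT (ihr a hT) using 1
      ring
    induction a generalizing t with
    | zero =>
      rw [gdMoment_zero_succ r ht.le, ← integral_const_mul]
      refine hasSum_integral_exp (hz (r + 1) 0) (fun T hT => ?_) ht
      refine (hB 0 T hT).congr_fun fun n => ?_
      rw [mul_assoc ((-1) ^ n), totalTerm_zero_mul]
    | succ a ih =>
      rw [gdMoment_succ_succ a r ht.le, ← integral_const_mul]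
      refine hasSum_integral_exp (hz (r + 1) (a + 1)) (fun T hT => ?_) ht
      rw [mul_add]
      refine ((hB (a + 1) T hT).add (ih hT)).congr_fun fun n => ?_
      rw [mul_assoc ((-1) ^ n), totalTerm_succ_mul]
      ring

theorem tendsto_gdMoment (a b : ℕ) :
    Tendsto (gdMoment a b) (𝓝[>] 0) (𝓝 (gdMoment a b 0)) := by
  have c1 := continuous_dpow a
  have c2 := continuous_dpow b
  have c5 := continuous_gd
  have c6 := continuous_sech
  set F : ℝ → ℝ → ℝ := fun t => (Ioi t).indicator
    (fun T => dpow a (T - t) * dpow b (gd T - gd t) * sech T) with hF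
  have hval : ∀ t, 0 ≤ t → gdMoment a b t = ∫ T in Ioi 0, F t T := fun t ht => by
    rw [gdMoment, hF, setIntegral_indicator measurableSet_Ioi, inter_eq_right.2 (Ioi_subset_Ioi ht)]
  rw [hval 0 le_rfl]
  have hev : (fun t => ∫ T in Ioi 0, F t T) =ᶠ[𝓝[>] 0] gdMoment a b := by
    filter_upwards [self_mem_nhdsWithin] with t ht
    exact (hval t (le_of_lt ht)).symm
  refine Tendsto.congr' hev ?_
  refine tendsto_integral_filter_of_dominated_convergence
    (fun T => 2 ^ a * dpow b (Real.pi / 2) * Real.exp (T / 2) * sech T) ?_ ?_ ?_ ?_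
  · refine Eventually.of_forall fun t => ?_
    refine AEStronglyMeasurable.indicator ?_ measurableSet_Ioi
    exact Continuous.aestronglyMeasurable (by fun_prop)
  · filter_upwards [self_mem_nhdsWithin] with t ht
    refine (ae_restrict_iff' measurableSet_Ioi).2 (Eventually.of_forall fun T hT => ?_)
    simp only [hF, Real.norm_eq_abs]
    by_cases h : t < T
    · rw [indicator_of_mem (by exact h), abs_mul, abs_of_pos (sech_pos T),
        abs_of_nonneg (dpow_mul_dpow_gd_nonneg a b h.le)]
      exact mul_le_mul_of_nonneg_right (dpow_mul_dpow_gd_le a b (le_of_lt ht) h.le)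
        (sech_pos T).le
    · rw [indicator_of_notMem (by exact h), abs_zero]
      have := sech_pos T
      have := dpow_nonneg b (x := Real.pi / 2) (by positivity)
      positivity
  · refine integrableOn_mul_sech (C := 2 ^ a * dpow b (Real.pi / 2)) (by fun_prop) fun T _ => ?_
    have := dpow_nonneg b (x := Real.pi / 2) (by positivity)
    rw [abs_of_nonneg (by positivity)]
  · refine (ae_restrict_iff' measurableSet_Ioi).2 (Eventually.of_forall fun T hT => ?_)
    have hc : Tendsto (fun t => dpow a (T - t) * dpow b (gd T - gd t) * sech T) (𝓝[>] 0)
        (𝓝 (dpow a (T - 0) * dpow b (gd T - gd 0) * sech T)) :=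
      (Continuous.tendsto (by fun_prop) 0).mono_left nhdsWithin_le_nhds
    have h0 : F 0 T = dpow a (T - 0) * dpow b (gd T - gd 0) * sech T :=
      indicator_of_mem hT _
    rw [h0]
    refine hc.congr' ?_
    filter_upwards [mem_nhdsWithin_of_mem_nhds (Iio_mem_nhds (mem_Ioi.1 hT))] with t ht
    exact (indicator_of_mem (show T ∈ Ioi t from ht)
      (fun T => dpow a (T - t) * dpow b (gd T - gd t) * sech T)).symm

/-- Abel's limit theorem in the variable e^(-2t) as t → 0+, needed because at t = 0 the series may
converge only conditionally. -/
theorem W_eq_gdMoment (r a : ℕ) :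
    W (a + r + 1) (r + 1) = (-1) ^ (r + 1) * gdMoment a r 0 := by
  have h1 := Real.tendsto_tsum_powerSeries_nhdsWithin_lt (tendsto_W r a)
  have hv : Tendsto (fun t : ℝ => Real.exp (-(2 * t))) (𝓝[>] 0) (𝓝[<] 1) := by
    refine tendsto_nhdsWithin_iff.2 ⟨?_, ?_⟩
    · have : Tendsto (fun t : ℝ => Real.exp (-(2 * t))) (𝓝 0) (𝓝 (Real.exp (-(2 * 0)))) :=
        Continuous.tendsto (by fun_prop) 0
      simp only [mul_zero, neg_zero, Real.exp_zero] at this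
      exact this.mono_left nhdsWithin_le_nhds
    · filter_upwards [self_mem_nhdsWithin] with t ht
      rw [mem_Iio, Real.exp_lt_one_iff]
      linarith [mem_Ioi.1 ht]
  have h2 := h1.comp hv
  have h3 : Tendsto (fun t : ℝ => -Real.exp ((1 - r) * t) * ((-1) ^ r * gdMoment a r t)) (𝓝[>] 0)
      (𝓝 (-1 * ((-1) ^ r * gdMoment a r 0))) := by
    refine Tendsto.mul ?_ ((tendsto_gdMoment a r).const_mul _)
    have : Tendsto (fun t : ℝ => -Real.exp ((1 - r) * t)) (𝓝 0)
        (𝓝 (-Real.exp ((1 - r) * 0))) := Continuous.tendsto (by fun_prop) 0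
    simp only [mul_zero, Real.exp_zero] at this
    exact this.mono_left nhdsWithin_le_nhds
  have h4 := tendsto_nhds_unique (h2.congr' ?_) h3
  · rw [h4]
    ring
  · filter_upwards [self_mem_nhdsWithin] with t ht
    rw [← ((hasSum_totalTerm r a ht).mul_left (-Real.exp ((1 - r) * t))).tsum_eq]
    refine tsum_congr fun n => ?_
    rw [← Real.exp_nat_mul, show (n : ℝ) * -(2 * t) =
      (1 - r) * t + -((2 * (n : ℝ) + 1 - r) * t) by ring, Real.exp_add]
    ring

theorem W_eq_integral {j m : ℕ} (hj : 1 ≤ j) (hm : 1 ≤ m) :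
    W (2 * j + 2 * m - 1) (2 * m) =
      ∫ t in Ioi (0 : ℝ), dpow (2 * j - 1) t * dpow (2 * m - 1) (gd t) * sech t := by
  have h := W_eq_gdMoment (2 * m - 1) (2 * j - 1)
  rw [show 2 * j - 1 + (2 * m - 1) + 1 = 2 * j + 2 * m - 1 by omega,
    show 2 * m - 1 + 1 = 2 * m by omega, pow_mul] at h
  simpa [gdMoment, gd_zero] using h

/-! ### The contour integral over a half-strip. -/

/-- The Cayley transform of `exp (-S)`, that is, `tanh (S / 2)`. -/
noncomputable def cayleyExp (S : ℂ) : ℂ := (1 - Complex.exp (-S)) / (1 + Complex.exp (-S))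

/-- The integrand `exp (x S) (tanh (S / 2) ^ y - 1)`. -/
noncomputable def contourFun (x y : ℝ) (S : ℂ) : ℂ :=
  Complex.exp (x * S) * (cayleyExp S ^ (y : ℂ) - 1)

theorem re_exp_neg_nonneg {S : ℂ} (h1 : -(Real.pi / 2) ≤ S.im) (h2 : S.im ≤ Real.pi / 2) :
    0 ≤ (Complex.exp (-S)).re := by
  rw [Complex.exp_re, Complex.neg_im, Real.cos_neg]
  exact mul_nonneg (Real.exp_pos _).le (Real.cos_nonneg_of_mem_Icc ⟨h1, h2⟩)

theorem one_add_exp_neg_ne_zero {S : ℂ} (h1 : -(Real.pi / 2) ≤ S.im) (h2 : S.im ≤ Real.pi / 2) :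
    1 + Complex.exp (-S) ≠ 0 := fun h => by
  have := re_exp_neg_nonneg h1 h2
  have h' := congrArg Complex.re h
  simp only [Complex.add_re, Complex.one_re, Complex.zero_re] at h'
  linarith

/-- Shows that, inside the closed strip |Im S| ≤ π/2, points with Re S > 0 are sent to the right
half-plane, where the principal power is holomorphic. -/
theorem re_cayleyExp (S : ℂ) : (cayleyExp S).re =
    (1 - Real.exp (-(2 * S.re))) / Complex.normSq (1 + Complex.exp (-S)) := by
  have h : Complex.normSq (Complex.exp (-S)) = Real.exp (-(2 * S.re)) := by
    rw [Complex.normSq_eq_norm_sq, Complex.norm_exp, ← Real.exp_nat_mul]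
    simp
  rw [← h, cayleyExp, Complex.div_re, ← add_div, Complex.normSq_apply (Complex.exp (-S))]
  congr 1
  simp only [Complex.sub_re, Complex.add_re, Complex.sub_im, Complex.add_im, Complex.one_re,
    Complex.one_im]
  ring

theorem re_cayleyExp_nonneg {S : ℂ} (h : 0 ≤ S.re) : 0 ≤ (cayleyExp S).re := by
  rw [re_cayleyExp]
  refine div_nonneg (sub_nonneg.2 (Real.exp_le_one_iff.2 (by linarith))) (Complex.normSq_nonneg _)

theorem re_cayleyExp_pos {S : ℂ} (h : 0 < S.re) (h1 : -(Real.pi / 2) ≤ S.im)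
    (h2 : S.im ≤ Real.pi / 2) : 0 < (cayleyExp S).re := by
  rw [re_cayleyExp]
  refine div_pos (sub_pos.2 (Real.exp_lt_one_iff.2 (by linarith)))
    (Complex.normSq_pos.2 (one_add_exp_neg_ne_zero h1 h2))

theorem continuousAt_cayleyExp {S : ℂ} (h1 : -(Real.pi / 2) ≤ S.im) (h2 : S.im ≤ Real.pi / 2) :
    ContinuousAt cayleyExp S := by
  unfold cayleyExp
  have := one_add_exp_neg_ne_zero h1 h2
  fun_prop (disch := assumption)

/-- At the corner S = 0 the base of the power is 0, and continuity there rests on y > 0. -/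
theorem continuousAt_contourFun (x : ℝ) {y : ℝ} (hy : 0 < y) {S : ℂ} (h : 0 ≤ S.re)
    (h1 : -(Real.pi / 2) ≤ S.im) (h2 : S.im ≤ Real.pi / 2) :
    ContinuousAt (contourFun x y) S := by
  unfold contourFun
  have hc : ContinuousAt (fun S => cayleyExp S ^ (y : ℂ)) S :=
    ContinuousAt.comp (f := cayleyExp) (g := fun z : ℂ => z ^ (y : ℂ))
      (Complex.continuousAt_cpow_const_of_re_pos (Or.inl (re_cayleyExp_nonneg h)) (by simpa))
      (continuousAt_cayleyExp h1 h2)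
  fun_prop

theorem differentiableAt_contourFun (x y : ℝ) {S : ℂ} (h : 0 < S.re)
    (h1 : -(Real.pi / 2) ≤ S.im) (h2 : S.im ≤ Real.pi / 2) :
    DifferentiableAt ℂ (contourFun x y) S := by
  have h0 := one_add_exp_neg_ne_zero h1 h2
  have hq : DifferentiableAt ℂ cayleyExp S := by
    unfold cayleyExp
    fun_prop (disch := assumption)
  have hs : cayleyExp S ∈ Complex.slitPlane := Or.inl (re_cayleyExp_pos h h1 h2)
  have hc : DifferentiableAt ℂ (fun S => cayleyExp S ^ (y : ℂ)) S :=
    hq.cpow (differentiableAt_const _) hs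
  unfold contourFun
  fun_prop

theorem one_sub_ofReal_mul_I_ne_zero (u : ℝ) : (1 - u * Complex.I) ≠ 0 := fun h => by
  have := congrArg Complex.re h
  simp at this

theorem exp_two_mul_arctan (u : ℝ) :
    Complex.exp ((2 * Real.arctan u : ℝ) * Complex.I) =
      (1 + u * Complex.I) / (1 - u * Complex.I) := by
  have hc : (Real.cos (Real.arctan u) : ℂ) ≠ 0 :=
    Complex.ofReal_ne_zero.2 (Real.cos_arctan_pos u).ne'
  have hs : (Real.sin (Real.arctan u) : ℂ) = u * Real.cos (Real.arctan u) := by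
    have h := Real.tan_arctan u
    rw [Real.tan_eq_sin_div_cos, div_eq_iff (Real.cos_arctan_pos u).ne'] at h
    exact_mod_cast h
  have h1 : Complex.exp (Real.arctan u * Complex.I) =
      Real.cos (Real.arctan u) * (1 + u * Complex.I) := by
    rw [Complex.exp_mul_I, ← Complex.ofReal_cos, ← Complex.ofReal_sin, hs]
    ring
  have h2 : Complex.exp (-(Real.arctan u * Complex.I)) =
      Real.cos (Real.arctan u) * (1 - u * Complex.I) := by
    rw [← neg_mul, Complex.exp_mul_I, Complex.cos_neg, Complex.sin_neg, ← Complex.ofReal_cos,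
      ← Complex.ofReal_sin, hs]
    ring
  rw [eq_div_iff (one_sub_ofReal_mul_I_ne_zero u), ← mul_right_inj' hc]
  calc _ = Complex.exp ((2 * Real.arctan u : ℝ) * Complex.I) *
        Complex.exp (-(Real.arctan u * Complex.I)) := by rw [h2]; ring
    _ = Complex.exp (Real.arctan u * Complex.I) := by
      rw [← Complex.exp_add]
      congr 1
      push_cast
      ring
    _ = _ := h1

theorem pi_div_two_sub_gd (t : ℝ) :
    Real.pi / 2 - gd t = 2 * Real.arctan (Real.exp (-t)) := by
  rw [gd]
  ring

/-- On this edge tanh(S/2) = e^(-i(π/2 - gd t)) has modulus 1 and argument in (-π, π], so its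
principal power is explicit. -/
theorem im_contourFun_bottom (x y : ℝ) {t : ℝ} (ht : 0 ≤ t) :
    (contourFun x y (t + (-(Real.pi / 2) : ℝ) * Complex.I)).im =
      Real.exp (x * t) * (Real.sin (Real.pi / 2 * x) -
        Real.sin (Real.pi / 2 * (x + y) - y * gd t)) := by
  set u := Real.exp (-t) with hu
  have h1 : Complex.exp (-(t + (-(Real.pi / 2) : ℝ) * Complex.I)) = u * Complex.I := by
    rw [hu, neg_add, Complex.exp_add, Complex.ofReal_exp]
    push_cast
    rw [neg_mul, neg_neg, Complex.exp_pi_div_two_mul_I]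
  have h2 : cayleyExp (t + (-(Real.pi / 2) : ℝ) * Complex.I) =
      Complex.exp ((-(Real.pi / 2 - gd t) : ℝ) * Complex.I) := by
    rw [cayleyExp, h1, pi_div_two_sub_gd, Complex.ofReal_neg, neg_mul, Complex.exp_neg,
      exp_two_mul_arctan, inv_div]
  have hg := gd_nonneg ht
  have hg' := gd_lt_pi_div_two t
  have hpi := Real.pi_pos
  have h3 : cayleyExp (t + (-(Real.pi / 2) : ℝ) * Complex.I) ^ (y : ℂ) =
      Complex.exp ((-(Real.pi / 2 - gd t) * y : ℝ) * Complex.I) := by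
    rw [h2, Complex.cpow_def_of_ne_zero (Complex.exp_ne_zero _), Complex.log_exp]
    · congr 1
      push_cast
      ring
    · rw [Complex.im_ofReal_mul, Complex.I_im]
      linarith
    · rw [Complex.im_ofReal_mul, Complex.I_im]
      linarith
  have h4 : contourFun x y (t + (-(Real.pi / 2) : ℝ) * Complex.I) =
      Complex.exp ((x * t : ℝ) + (-(Real.pi / 2 * (x + y) - y * gd t) : ℝ) * Complex.I) -
      Complex.exp ((x * t : ℝ) + (-(Real.pi / 2 * x) : ℝ) * Complex.I) := by
    rw [contourFun, h3, mul_sub, mul_one, ← Complex.exp_add]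
    congr 2
    · push_cast
      ring
    · push_cast
      ring
  rw [h4, Complex.sub_im, Complex.exp_im, Complex.exp_im]
  simp only [Complex.add_re, Complex.add_im, Complex.ofReal_re, Complex.ofReal_im,
    Complex.re_ofReal_mul, Complex.im_ofReal_mul, Complex.I_re, Complex.I_im, mul_zero, mul_one,
    add_zero, zero_add, Real.sin_neg]
  ring

/-- The mirror image of the bottom edge: now S is imaginary and given by gd t, while tanh(S/2) = -i
e^(-t). -/
theorem re_contourFun_left (x y t : ℝ) :
    (contourFun x y ((gd t - Real.pi / 2 : ℝ) * Complex.I)).re =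
      Real.cos (Real.pi / 2 * (x + y) - x * gd t) * Real.exp (-(y * t)) -
        Real.cos (Real.pi / 2 * x - x * gd t) := by
  set u := Real.exp (-t) with hu
  have hn1 := one_sub_ofReal_mul_I_ne_zero u
  have h1 : Complex.exp (-((gd t - Real.pi / 2 : ℝ) * Complex.I)) =
      (1 + u * Complex.I) / (1 - u * Complex.I) := by
    rw [← exp_two_mul_arctan, ← pi_div_two_sub_gd]
    congr 1
    push_cast
    ring
  have h2 : cayleyExp ((gd t - Real.pi / 2 : ℝ) * Complex.I) =
      Complex.exp ((-t : ℝ) + (-(Real.pi / 2) : ℝ) * Complex.I) := by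
    rw [Complex.exp_add, ← Complex.ofReal_exp, ← hu, cayleyExp, h1]
    have : Complex.exp ((-(Real.pi / 2) : ℝ) * Complex.I) = -Complex.I := by
      push_cast
      rw [neg_mul, Complex.exp_neg, Complex.exp_pi_div_two_mul_I, Complex.inv_I]
    rw [this]
    have h5 : 1 + (1 + u * Complex.I) / (1 - u * Complex.I) ≠ 0 := by
      have : 1 + (1 + u * Complex.I) / (1 - u * Complex.I) = 2 / (1 - u * Complex.I) := by
        field_simp
        ring
      rw [this]
      exact div_ne_zero two_ne_zero hn1
    rw [div_eq_iff h5]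
    field_simp
    ring
  have hpi := Real.pi_pos
  have h3 : cayleyExp ((gd t - Real.pi / 2 : ℝ) * Complex.I) ^ (y : ℂ) =
      Complex.exp ((-(y * t) : ℝ) + (-(Real.pi / 2) * y : ℝ) * Complex.I) := by
    rw [h2, Complex.cpow_def_of_ne_zero (Complex.exp_ne_zero _), Complex.log_exp]
    · congr 1
      push_cast
      ring
    · rw [Complex.add_im, Complex.ofReal_im, Complex.im_ofReal_mul, Complex.I_im]
      linarith
    · rw [Complex.add_im, Complex.ofReal_im, Complex.im_ofReal_mul, Complex.I_im]
      linarith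
  have h4 : contourFun x y ((gd t - Real.pi / 2 : ℝ) * Complex.I) =
      Complex.exp ((-(y * t) : ℝ) + (-(Real.pi / 2 * (x + y) - x * gd t) : ℝ) * Complex.I) -
      Complex.exp ((0 : ℝ) + (-(Real.pi / 2 * x - x * gd t) : ℝ) * Complex.I) := by
    rw [contourFun, h3, mul_sub, mul_one, ← Complex.exp_add]
    congr 2
    · push_cast
      ring
    · push_cast
      ring
  rw [h4, Complex.sub_re, Complex.exp_re, Complex.exp_re]
  simp only [Complex.add_re, Complex.add_im, Complex.ofReal_re, Complex.ofReal_im,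
    Complex.re_ofReal_mul, Complex.im_ofReal_mul, Complex.I_re, Complex.I_im, mul_zero, mul_one,
    add_zero, zero_add, Real.cos_neg, Real.exp_zero]
  ring

theorem im_contourFun_top (x y : ℝ) {t : ℝ} (ht : 0 ≤ t) : (contourFun x y t).im = 0 := by
  have h2 : cayleyExp t = (((1 - Real.exp (-t)) / (1 + Real.exp (-t)) : ℝ) : ℂ) := by
    rw [cayleyExp]
    push_cast
    rfl
  have h3 : 0 ≤ (1 - Real.exp (-t)) / (1 + Real.exp (-t)) := by
    have := Real.exp_pos (-t)
    exact div_nonneg (sub_nonneg.2 (Real.exp_le_one_iff.2 (by linarith))) (by positivity)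
  rw [contourFun, h2, ← Complex.ofReal_cpow h3, ← Complex.ofReal_mul, ← Complex.ofReal_exp,
    ← Complex.ofReal_one, ← Complex.ofReal_sub, ← Complex.ofReal_mul, Complex.ofReal_im]

/-- As a function of U = e^(-S), tanh(S/2)^y is differentiable at U = 0 with value 1. Subtracting 1
therefore gains a factor e^(-R), uniformly in the imaginary part. -/
theorem exists_norm_contourFun_le (x y : ℝ) :
    ∃ C R₀ : ℝ, ∀ R η : ℝ, R₀ ≤ R →
      ‖contourFun x y (R + η * Complex.I)‖ ≤ C * Real.exp (-((1 - x) * R)) := by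
  have hd : DifferentiableAt ℂ (fun U : ℂ => ((1 - U) / (1 + U)) ^ (y : ℂ)) 0 := by
    have h1 : (1 : ℂ) + 0 ≠ 0 := by simp
    have hq : DifferentiableAt ℂ (fun U : ℂ => (1 - U) / (1 + U)) 0 := by
      fun_prop (disch := assumption)
    exact hq.cpow (differentiableAt_const _) (by simp)
  obtain ⟨C, hC⟩ := hd.isBigO_sub.bound
  obtain ⟨δ, hδ, h⟩ := Metric.eventually_nhds_iff.1 hC
  have hlim := Real.tendsto_exp_neg_atTop_nhds_zero.eventually (gt_mem_nhds hδ)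
  obtain ⟨R₀, hR₀⟩ := eventually_atTop.1 hlim
  refine ⟨C, R₀, fun R η hR => ?_⟩
  have hn : ‖Complex.exp (-(R + η * Complex.I))‖ = Real.exp (-R) := by
    rw [Complex.norm_exp]
    simp
  have h2 := h (y := Complex.exp (-(R + η * Complex.I))) (by
    rw [dist_zero_right, hn]
    exact hR₀ R hR)
  simp only [sub_zero, add_zero, div_one, Complex.one_cpow, hn] at h2
  rw [contourFun, norm_mul, Complex.norm_exp]
  have h3 : (x * (R + η * Complex.I) : ℂ).re = x * R := by simp
  rw [h3, show -((1 - x) * R) = x * R + -R by ring, Real.exp_add]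
  calc _ ≤ Real.exp (x * R) * (C * Real.exp (-R)) :=
        mul_le_mul_of_nonneg_left h2 (Real.exp_pos _).le
    _ = _ := by ring

theorem pi_div_two_sub_gd_le (t : ℝ) : Real.pi / 2 - gd t ≤ 2 * Real.exp (-t) := by
  have h := Real.le_tan (Real.arctan_nonneg.2 (Real.exp_pos (-t)).le) (Real.arctan_lt_pi_div_two _)
  rw [Real.tan_arctan] at h
  rw [pi_div_two_sub_gd]
  linarith

theorem abs_bottom_le (x y t : ℝ) :
    |Real.exp (x * t) * (Real.sin (Real.pi / 2 * x) -
      Real.sin (Real.pi / 2 * (x + y) - y * gd t))| ≤ 2 * |y| * Real.exp (-((1 - x) * t)) := by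
  rw [abs_mul, Real.abs_exp]
  have h := Real.abs_sin_sub_sin_le (Real.pi / 2 * x) (Real.pi / 2 * (x + y) - y * gd t)
  rw [show Real.pi / 2 * x - (Real.pi / 2 * (x + y) - y * gd t) = -(y * (Real.pi / 2 - gd t)) by ring,
    abs_neg, abs_mul,
    abs_of_nonneg (a := Real.pi / 2 - gd t) (by linarith [gd_lt_pi_div_two t])] at h
  have h2 := h.trans (mul_le_mul_of_nonneg_left (pi_div_two_sub_gd_le t) (abs_nonneg y))
  calc _ ≤ Real.exp (x * t) * (|y| * (2 * Real.exp (-t))) :=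
        mul_le_mul_of_nonneg_left h2 (Real.exp_pos _).le
    _ = _ := by
      rw [show -((1 - x) * t) = x * t + -t by ring, Real.exp_add]
      ring

theorem continuous_bottom (x y : ℝ) :
    Continuous fun t => Real.exp (x * t) * (Real.sin (Real.pi / 2 * x) -
      Real.sin (Real.pi / 2 * (x + y) - y * gd t)) := by
  have := continuous_gd
  fun_prop

theorem integrableOn_bottom {x : ℝ} (hx : x < 1) (y : ℝ) :
    IntegrableOn (fun t => Real.exp (x * t) * (Real.sin (Real.pi / 2 * x) -
      Real.sin (Real.pi / 2 * (x + y) - y * gd t))) (Ioi 0) :=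
  Integrable.mono' ((integrableOn_exp_neg_mul_Ioi (sub_pos.2 hx) 0).const_mul (2 * |y|))
    (continuous_bottom x y).aestronglyMeasurable
    (Eventually.of_forall fun t => abs_bottom_le x y t)

theorem contour_rect (x : ℝ) {y R : ℝ} (hy : 0 < y) (hR : 0 ≤ R) :
    (∫ t in (0 : ℝ)..R, Real.exp (x * t) * (Real.sin (Real.pi / 2 * x) -
        Real.sin (Real.pi / 2 * (x + y) - y * gd t))) +
      (∫ η in (-(Real.pi / 2))..0, contourFun x y (R + η * Complex.I)).re =
      ∫ η in (-(Real.pi / 2))..0, (contourFun x y (η * Complex.I)).re := by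
  have hpi := Real.pi_pos
  have hcont : ∀ S ∈ (uIcc 0 R ×ℂ uIcc (-(Real.pi / 2)) 0), ContinuousAt (contourFun x y) S := by
    rintro S ⟨h1, h2⟩
    simp only [mem_preimage, uIcc_of_le hR, uIcc_of_le (by linarith : -(Real.pi / 2) ≤ 0),
      mem_Icc] at h1 h2
    exact continuousAt_contourFun x hy h1.1 h2.1 (by linarith)
  have hrect := Complex.integral_boundary_rect_eq_zero_of_continuousOn_of_differentiableOn
    (contourFun x y) ((-(Real.pi / 2) : ℝ) * Complex.I) (R : ℂ)
    (by
      simp only [Complex.re_ofReal_mul, Complex.im_ofReal_mul, Complex.I_re, Complex.I_im, mul_zero,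
        mul_one, Complex.ofReal_re, Complex.ofReal_im]
      exact fun S hS => (hcont S hS).continuousWithinAt)
    (by
      simp only [Complex.re_ofReal_mul, Complex.im_ofReal_mul, Complex.I_re, Complex.I_im, mul_zero,
        mul_one, Complex.ofReal_re, Complex.ofReal_im]
      rintro S ⟨h1, h2⟩
      simp only [mem_preimage, min_eq_left hR, max_eq_right hR,
        min_eq_left (by linarith : -(Real.pi / 2) ≤ 0),
        max_eq_right (by linarith : -(Real.pi / 2) ≤ 0), mem_Ioo] at h1 h2
      exact (differentiableAt_contourFun x y h1.1 h2.1.le (by linarith)).differentiableWithinAt)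
  simp only [Complex.re_ofReal_mul, Complex.im_ofReal_mul, Complex.I_re, Complex.I_im, mul_zero,
    mul_one, Complex.ofReal_re, Complex.ofReal_im, Complex.ofReal_zero, zero_mul, add_zero,
    zero_add, smul_eq_mul] at hrect
  -- Taking imaginary parts removes the top edge, where the integrand is real, and turns the
  -- vertical edges into real parts through the factor i.
  have him := congrArg Complex.im hrect
  simp only [Complex.add_im, Complex.sub_im, Complex.I_mul_im, Complex.zero_im] at him
  have hmem : ∀ {a b : ℝ}, a ∈ uIcc 0 R → b ∈ uIcc (-(Real.pi / 2)) 0 →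
      ContinuousAt (contourFun x y) (a + b * Complex.I) := fun {a b} ha hb =>
    hcont _ ⟨by simpa using ha, by simpa using hb⟩
  have i1 : IntervalIntegrable (fun t : ℝ => contourFun x y (t + (-(Real.pi / 2) : ℝ) * Complex.I))
      volume 0 R := by
    refine ContinuousOn.intervalIntegrable fun t ht => ContinuousAt.continuousWithinAt ?_
    exact ContinuousAt.comp (f := fun t : ℝ => (t + (-(Real.pi / 2) : ℝ) * Complex.I : ℂ))
      (hmem ht (by simp)) (by fun_prop)
  have i2 : IntervalIntegrable (fun t : ℝ => contourFun x y t) volume 0 R := by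
    refine ContinuousOn.intervalIntegrable fun t ht => ContinuousAt.continuousWithinAt ?_
    have := hmem ht (right_mem_uIcc (a := -(Real.pi / 2)) (b := 0))
    simp only [Complex.ofReal_zero, zero_mul, add_zero] at this
    exact ContinuousAt.comp (f := fun t : ℝ => (t : ℂ)) this (by fun_prop)
  have i3 : IntervalIntegrable (fun η : ℝ => contourFun x y (η * Complex.I)) volume
      (-(Real.pi / 2)) 0 := by
    refine ContinuousOn.intervalIntegrable fun t ht => ContinuousAt.continuousWithinAt ?_
    have := hmem (left_mem_uIcc (a := 0) (b := R)) ht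
    simp only [Complex.ofReal_zero, zero_add] at this
    exact ContinuousAt.comp (f := fun t : ℝ => (t * Complex.I : ℂ)) this (by fun_prop)
  have e1 := Complex.imCLM.intervalIntegral_comp_comm i1
  have e2 := Complex.imCLM.intervalIntegral_comp_comm i2
  have e3 := Complex.reCLM.intervalIntegral_comp_comm i3
  simp only [Complex.imCLM_apply, Complex.reCLM_apply] at e1 e2 e3
  rw [← e1, ← e2, ← e3] at him
  have e4 : ∫ t in (0 : ℝ)..R, (contourFun x y t).im = 0 := by
    rw [intervalIntegral.integral_congr (g := fun _ => 0), intervalIntegral.integral_zero]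
    intro t ht
    rw [uIcc_of_le hR] at ht
    exact im_contourFun_top x y ht.1
  have e5 : ∫ t in (0 : ℝ)..R, (contourFun x y (t + (-(Real.pi / 2) : ℝ) * Complex.I)).im =
      ∫ t in (0 : ℝ)..R, Real.exp (x * t) * (Real.sin (Real.pi / 2 * x) -
        Real.sin (Real.pi / 2 * (x + y) - y * gd t)) := by
    refine intervalIntegral.integral_congr fun t ht => ?_
    rw [uIcc_of_le hR] at ht
    exact im_contourFun_bottom x y ht.1
  rw [e4, e5] at him
  linarith

theorem contour_limit {x y : ℝ} (hx : x < 1) (hy : 0 < y) :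
    ∫ t in Ioi (0 : ℝ), Real.exp (x * t) * (Real.sin (Real.pi / 2 * x) -
        Real.sin (Real.pi / 2 * (x + y) - y * gd t)) =
      ∫ η in (-(Real.pi / 2))..0, (contourFun x y (η * Complex.I)).re := by
  have h1 := intervalIntegral_tendsto_integral_Ioi 0 (integrableOn_bottom hx y) tendsto_id
  have h2 : Tendsto (fun R : ℝ => (∫ η in (-(Real.pi / 2))..0,
      contourFun x y (R + η * Complex.I)).re) atTop (𝓝 0) := by
    obtain ⟨C, R₀, h⟩ := exists_norm_contourFun_le x y
    refine squeeze_zero_norm' (a := fun R => C * Real.exp (-((1 - x) * R)) *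
      |0 - -(Real.pi / 2)|) ?_ ?_
    · filter_upwards [eventually_ge_atTop R₀] with R hR
      refine (Complex.abs_re_le_norm _).trans ?_
      exact intervalIntegral.norm_integral_le_of_norm_le_const fun η _ => h R η hR
    · have : Tendsto (fun R : ℝ => Real.exp (-((1 - x) * R))) atTop (𝓝 0) :=
        Real.tendsto_exp_neg_atTop_nhds_zero.comp (tendsto_id.const_mul_atTop (sub_pos.2 hx))
      simpa using (this.const_mul C).mul_const |0 - -(Real.pi / 2)|
  have h3 := h1.add h2
  rw [add_zero] at h3
  refine tendsto_nhds_unique h3 (tendsto_const_nhds.congr' ?_)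
  filter_upwards [eventually_ge_atTop 0] with R hR
  exact (contour_rect x hy hR).symm

theorem image_gd_sub : (fun t => gd t - Real.pi / 2) '' Ioi 0 = Ioo (-(Real.pi / 2)) 0 := by
  ext η
  constructor
  · rintro ⟨t, ht, rfl⟩
    have h1 := gd_strictMono (mem_Ioi.1 ht)
    rw [gd_zero] at h1
    exact ⟨by dsimp only; linarith, by dsimp only; linarith [gd_lt_pi_div_two t]⟩
  · rintro ⟨h1, h2⟩
    obtain ⟨t, ht⟩ := (tendsto_gd_atTop.eventually (lt_mem_nhds
      (show η + Real.pi / 2 < Real.pi / 2 by linarith))).exists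
    have h0 : gd 0 < η + Real.pi / 2 := by rw [gd_zero]; linarith
    obtain ⟨s, hs, hs'⟩ := intermediate_value_Ioo (gd_strictMono.lt_iff_lt.1 (h0.trans ht)).le
      continuous_gd.continuousOn ⟨h0, ht⟩
    exact ⟨s, hs.1, by dsimp only; rw [hs']; ring⟩

/-- Substitution η = gd t - π/2, dη = sech t dt. -/
theorem integral_left (x y : ℝ) :
    ∫ η in (-(Real.pi / 2))..0, (contourFun x y (η * Complex.I)).re =
      ∫ t in Ioi (0 : ℝ), sech t * (Real.cos (Real.pi / 2 * (x + y) - x * gd t) *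
        Real.exp (-(y * t)) - Real.cos (Real.pi / 2 * x - x * gd t)) := by
  have hpi := Real.pi_pos
  rw [intervalIntegral.integral_of_le (by linarith), integral_Ioc_eq_integral_Ioo, ← image_gd_sub,
    integral_image_eq_integral_abs_deriv_smul (f' := sech) measurableSet_Ioi
      (fun t _ => ((hasDerivAt_gd t).sub_const _).hasDerivWithinAt)
      (fun s _ t _ h => gd_strictMono.injective (sub_left_injective h))]
  refine setIntegral_congr_fun measurableSet_Ioi fun t _ => ?_
  simp only [abs_of_pos (sech_pos t), smul_eq_mul]
  rw [re_contourFun_left]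

theorem integrableOn_exp_mul_sech {x : ℝ} (hx : x < 1) {g : ℝ → ℝ} (hg : Continuous g) {C : ℝ}
    (hC : ∀ t, |g t| ≤ C) : IntegrableOn (fun t => Real.exp (x * t) * g t * sech t) (Ioi 0) := by
  refine Integrable.mono' (g := fun t => 2 * C * Real.exp (-((1 - x) * t)))
    ((integrableOn_exp_neg_mul_Ioi (sub_pos.2 hx) 0).const_mul _) ?_
    (Eventually.of_forall fun t => ?_)
  · have := continuous_sech
    exact Continuous.aestronglyMeasurable (by fun_prop)
  · rw [Real.norm_eq_abs, abs_mul, abs_mul, Real.abs_exp, abs_of_pos (sech_pos t)]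
    have hC0 := (abs_nonneg _).trans (hC t)
    calc _ ≤ Real.exp (x * t) * C * (2 * Real.exp (-t)) := by
          gcongr
          · exact (sech_pos t).le
          · exact hC t
          · exact sech_le t
      _ = _ := by
        rw [show -((1 - x) * t) = x * t + -t by ring, Real.exp_add]
        ring

theorem integrableOn_exp_cos_sech {x : ℝ} (hx : x < 1) (α y : ℝ) :
    IntegrableOn (fun t => Real.exp (x * t) * Real.cos (α - y * gd t) * sech t) (Ioi 0) := by
  have := continuous_gd
  exact integrableOn_exp_mul_sech hx (by fun_prop) (fun t => Real.abs_cos_le_one _)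

/-- The combined integrand is the derivative of the bottom-edge function itself. That function
vanishes at infinity since gd t → π/2 fast enough for x < 1, so only the value at 0 remains. -/
theorem integral_bottom_by_parts {x : ℝ} (hx : x < 1) (y : ℝ) :
    x * (∫ t in Ioi (0 : ℝ), Real.exp (x * t) * (Real.sin (Real.pi / 2 * x) -
        Real.sin (Real.pi / 2 * (x + y) - y * gd t))) +
      y * (∫ t in Ioi (0 : ℝ), Real.exp (x * t) *
        Real.cos (Real.pi / 2 * (x + y) - y * gd t) * sech t) =
      Real.sin (Real.pi / 2 * (x + y)) - Real.sin (Real.pi / 2 * x) := by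
  have i1 := (integrableOn_bottom hx y).const_mul x
  have i2 := (integrableOn_exp_cos_sech hx (Real.pi / 2 * (x + y)) y).const_mul y
  rw [← integral_const_mul, ← integral_const_mul, ← integral_add i1 i2]
  have h := integral_Ioi_of_hasDerivAt_of_tendsto' (a := 0) (m := 0)
    (f := fun t => Real.exp (x * t) * (Real.sin (Real.pi / 2 * x) -
        Real.sin (Real.pi / 2 * (x + y) - y * gd t))) (fun t _ => ?_) (i1.add i2) ?_
  · refine h.trans ?_
    simp [gd_zero]
  · have d1 : HasDerivAt (fun t => Real.exp (x * t)) (Real.exp (x * t) * x) t := by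
      simpa using ((hasDerivAt_id t).const_mul x).exp
    have d2 := ((((hasDerivAt_gd t).const_mul y).const_sub
      (Real.pi / 2 * (x + y))).sin).const_sub (Real.sin (Real.pi / 2 * x))
    refine (d1.mul d2).congr_deriv ?_
    simp only [Pi.add_apply]
    ring
  · refine squeeze_zero_norm (fun t => abs_bottom_le x y t) ?_
    have : Tendsto (fun t : ℝ => Real.exp (-((1 - x) * t))) atTop (𝓝 0) :=
      Real.tendsto_exp_neg_atTop_nhds_zero.comp (tendsto_id.const_mul_atTop (sub_pos.2 hx))
    simpa using this.const_mul (2 * |y|)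

theorem integral_cos_gd_sech (x : ℝ) :
    x * ∫ t in Ioi (0 : ℝ), Real.cos (Real.pi / 2 * x - x * gd t) * sech t =
      Real.sin (Real.pi / 2 * x) := by
  have i1 := (integrableOn_exp_cos_sech zero_lt_one (Real.pi / 2 * x) x).const_mul x
  simp only [zero_mul, Real.exp_zero, one_mul] at i1
  rw [← integral_const_mul]
  have h := integral_Ioi_of_hasDerivAt_of_tendsto' (a := 0) (m := 0)
    (f := fun t => -Real.sin (Real.pi / 2 * x - x * gd t)) (fun t _ => ?_) i1 ?_
  · refine h.trans ?_
    simp [gd_zero]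
  · refine ((((hasDerivAt_gd t).const_mul x).const_sub (Real.pi / 2 * x)).sin).neg.congr_deriv ?_
    ring
  · have := ((Real.continuous_sin.tendsto _).comp
      ((tendsto_gd_atTop.const_mul x).const_sub (Real.pi / 2 * x))).neg
    rw [show Real.pi / 2 * x - x * (Real.pi / 2) = 0 by ring, Real.sin_zero, neg_zero] at this
    exact this

/-- The relation between the two one-sided transforms obtained from the contour integral. -/
theorem integral_exp_cos_add {x y : ℝ} (hx : x < 1) (hy : 0 < y) :
    y * (∫ t in Ioi (0 : ℝ), Real.exp (x * t) *
        Real.cos (Real.pi / 2 * (x + y) - y * gd t) * sech t) +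
      x * (∫ t in Ioi (0 : ℝ), Real.exp (-y * t) *
        Real.cos (Real.pi / 2 * (x + y) - x * gd t) * sech t) =
      Real.sin (Real.pi / 2 * (x + y)) := by
  have h1 := integral_bottom_by_parts hx y
  have h2 := integral_cos_gd_sech x
  rw [contour_limit hx hy, integral_left] at h1
  have i1 := integrableOn_exp_cos_sech (by linarith : -y < 1) (Real.pi / 2 * (x + y)) x
  have i2 := integrableOn_exp_cos_sech zero_lt_one (Real.pi / 2 * x) x
  simp only [zero_mul, Real.exp_zero, one_mul] at i2
  have h3 : ∫ t in Ioi (0 : ℝ), sech t * (Real.cos (Real.pi / 2 * (x + y) - x * gd t) *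
        Real.exp (-(y * t)) - Real.cos (Real.pi / 2 * x - x * gd t)) =
      (∫ t in Ioi (0 : ℝ), Real.exp (-y * t) *
        Real.cos (Real.pi / 2 * (x + y) - x * gd t) * sech t) -
      ∫ t in Ioi (0 : ℝ), Real.cos (Real.pi / 2 * x - x * gd t) * sech t := by
    rw [← integral_sub i1 i2]
    refine integral_congr_ae (Eventually.of_forall fun t => ?_)
    simp only [neg_mul]
    ring
  rw [h3] at h1
  linear_combination h1 + h2

theorem integrableOn_sinh_cos_sech {x : ℝ} (hx : |x| < 1) (α y : ℝ) :
    IntegrableOn (fun t => Real.sinh (x * t) * Real.cos (α - y * gd t) * sech t) (Ioi 0) := by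
  obtain ⟨h1, h2⟩ := abs_lt.1 hx
  have i1 := integrableOn_exp_cos_sech h2 α y
  have i2 := integrableOn_exp_cos_sech (by linarith : -x < 1) α y
  refine ((i1.sub i2).div_const 2).congr (Eventually.of_forall fun t => ?_)
  simp only [Pi.sub_apply, neg_mul]
  rw [Real.sinh_eq]
  ring

theorem integral_sinh_cos_sech {x : ℝ} (hx : |x| < 1) (α y : ℝ) :
    ∫ t in Ioi (0 : ℝ), Real.sinh (x * t) * Real.cos (α - y * gd t) * sech t =
      ((∫ t in Ioi (0 : ℝ), Real.exp (x * t) * Real.cos (α - y * gd t) * sech t) -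
        ∫ t in Ioi (0 : ℝ), Real.exp (-x * t) * Real.cos (α - y * gd t) * sech t) / 2 := by
  obtain ⟨h1, h2⟩ := abs_lt.1 hx
  rw [← integral_sub (integrableOn_exp_cos_sech h2 α y)
    (integrableOn_exp_cos_sech (by linarith : -x < 1) α y), ← integral_div]
  refine integral_congr_ae (Eventually.of_forall fun t => ?_)
  simp only [neg_mul]
  rw [Real.sinh_eq]
  ring

/-- The right side of `integral_exp_cos_add` is symmetric in x and y; subtracting the relation with
x and y exchanged leaves the hyperbolic sines. -/
theorem integral_sinh_cos_symm {x y : ℝ} (hx : 0 < x) (hx1 : x < 1) (hy : 0 < y) (hy1 : y < 1) :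
    y * (∫ t in Ioi (0 : ℝ), Real.sinh (x * t) *
        Real.cos (Real.pi / 2 * (x + y) - y * gd t) * sech t) =
      x * (∫ t in Ioi (0 : ℝ), Real.sinh (y * t) *
        Real.cos (Real.pi / 2 * (x + y) - x * gd t) * sech t) := by
  have h1 := integral_exp_cos_add hx1 hy
  have h2 := integral_exp_cos_add hy1 hx
  rw [add_comm y x] at h2
  rw [integral_sinh_cos_sech (abs_lt.2 ⟨by linarith, hx1⟩),
    integral_sinh_cos_sech (abs_lt.2 ⟨by linarith, hy1⟩)]
  linear_combination (h1 - h2) / 2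

/-! ### Power series in a parameter: identity theorem and termwise integration. -/

/-- The power series with coefficients `c`. -/
noncomputable def ofCoeffs (c : ℕ → ℝ) : FormalMultilinearSeries ℝ ℝ ℝ :=
  fun n => ContinuousMultilinearMap.mkPiRing ℝ (Fin n) (c n)

theorem coeff_ofCoeffs (c : ℕ → ℝ) (n : ℕ) : (ofCoeffs c).coeff n = c n := by
  simp [FormalMultilinearSeries.coeff, ofCoeffs]

theorem hasFPowerSeriesAt_of_hasSum {c : ℕ → ℝ} {F : ℝ → ℝ}
    (h : ∀ᶠ z in 𝓝 (0 : ℝ), HasSum (fun n => z ^ n • c n) (F z)) :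
    HasFPowerSeriesAt F (ofCoeffs c) 0 := by
  rw [hasFPowerSeriesAt_iff]
  filter_upwards [h] with z hz
  simpa only [coeff_ofCoeffs, zero_add] using hz

theorem eventually_eq_of_hasSum {c d : ℕ → ℝ} {F G : ℝ → ℝ}
    (hF : ∀ᶠ z in 𝓝 (0 : ℝ), HasSum (fun n => z ^ n • c n) (F z))
    (hG : ∀ᶠ z in 𝓝 (0 : ℝ), HasSum (fun n => z ^ n • d n) (G z))
    (h : ∀ᶠ z in 𝓝[>] (0 : ℝ), F z = G z) : ∀ᶠ z in 𝓝 (0 : ℝ), F z = G z :=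
  ((hasFPowerSeriesAt_of_hasSum hF).analyticAt.frequently_eq_iff_eventually_eq
    (hasFPowerSeriesAt_of_hasSum hG).analyticAt).1
    (h.frequently.filter_mono (nhdsWithin_mono _ fun _ hz => ne_of_gt hz))

theorem coeff_eq_of_hasSum {c d : ℕ → ℝ} {F G : ℝ → ℝ}
    (hF : ∀ᶠ z in 𝓝 (0 : ℝ), HasSum (fun n => z ^ n • c n) (F z))
    (hG : ∀ᶠ z in 𝓝 (0 : ℝ), HasSum (fun n => z ^ n • d n) (G z))
    (h : ∀ᶠ z in 𝓝[>] (0 : ℝ), F z = G z) (n : ℕ) : c n = d n := by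
  have h1 := (hasFPowerSeriesAt_of_hasSum hF).congr (eventually_eq_of_hasSum hF hG h)
  have h2 := h1.eq_formalMultilinearSeries (hasFPowerSeriesAt_of_hasSum hG)
  have h3 := congrArg (fun p => FormalMultilinearSeries.coeff p n) h2
  simpa only [coeff_ofCoeffs] using h3

/-- The coefficients of `a * z * F z` when `F` has coefficients `c`. -/
def shiftCoeff (a : ℝ) (c : ℕ → ℝ) : ℕ → ℝ
  | 0 => 0
  | n + 1 => a * c n

theorem hasSum_shiftCoeff {c : ℕ → ℝ} {F : ℝ → ℝ}
    (hF : ∀ᶠ z in 𝓝 (0 : ℝ), HasSum (fun n => z ^ n • c n) (F z)) (a : ℝ) :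
    ∀ᶠ z in 𝓝 (0 : ℝ), HasSum (fun n => z ^ n • shiftCoeff a c n) (a * (z * F z)) := by
  filter_upwards [hF] with z hz
  have h : HasSum (fun n => z ^ (n + 1) * (a * c n)) (a * (z * F z)) := by
    rw [← mul_assoc]
    refine (hz.mul_left (a * z)).congr_fun fun n => ?_
    rw [smul_eq_mul, pow_succ]
    ring
  rw [← hasSum_nat_add_iff' 1]
  simpa [shiftCoeff] using h

theorem hasSum_const_mul_coeff {c : ℕ → ℝ} {F : ℝ → ℝ}
    (hF : ∀ᶠ z in 𝓝 (0 : ℝ), HasSum (fun n => z ^ n • c n) (F z)) (a : ℝ) :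
    ∀ᶠ z in 𝓝 (0 : ℝ), HasSum (fun n => z ^ n • (a * c n)) (a * F z) := by
  filter_upwards [hF] with z hz
  refine (hz.mul_left a).congr_fun fun n => ?_
  simp only [smul_eq_mul]
  exact mul_left_comm _ _ _

/-- Termwise integration of a kernel given by an exponentially convergent power series. -/
theorem eventually_hasSum_integral {g : ℝ → ℝ} (hg : Continuous g) {C δ K : ℝ} (hδ : 0 < δ)
    (hC : ∀ t, 0 < t → |g t| ≤ C * Real.exp (-(δ * t))) {q : ℕ → ℝ → ℝ}
    (hqc : ∀ n, Continuous (q n)) (hq : ∀ n t, 0 < t → |q n t| ≤ dpow n (t + K))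
    {κ : ℝ → ℝ → ℝ} (hκ : ∀ z t, HasSum (fun n => z ^ n * q n t) (κ z t)) :
    ∀ᶠ z in 𝓝 (0 : ℝ), HasSum (fun n => z ^ n • ∫ t in Ioi (0 : ℝ), g t * q n t)
      (∫ t in Ioi (0 : ℝ), g t * κ z t) := by
  -- Any radius below δ would do: the dominating sum is a multiple of e^(-(δ - |z|)t).
  have hball : ∀ᶠ z in 𝓝 (0 : ℝ), |z| < δ / 2 := by
    have := Metric.ball_mem_nhds (0 : ℝ) (half_pos hδ)
    filter_upwards [this] with z hz
    simpa using hz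
  filter_upwards [hball] with z hz
  have hC0 : 0 ≤ C := by
    have := (abs_nonneg _).trans (hC 1 one_pos)
    exact nonneg_of_mul_nonneg_left this (Real.exp_pos _)
  have hexp : ∀ t : ℝ, HasSum (fun n : ℕ => C * Real.exp (-(δ * t)) * (|z| ^ n * dpow n (t + K)))
      (C * Real.exp (-(δ * t)) * Real.exp (|z| * (t + K))) := by
    intro t
    refine HasSum.mul_left _ ?_
    have := NormedSpace.expSeries_div_hasSum_exp (|z| * (t + K))
    rw [← Real.exp_eq_exp_ℝ] at this
    refine this.congr_fun fun n => ?_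
    rw [dpow, mul_pow]
    ring
  have h := hasSum_integral_of_dominated_convergence (μ := volume.restrict (Ioi (0 : ℝ)))
    (F := fun n t => z ^ n * (g t * q n t)) (f := fun t => g t * κ z t)
    (fun n t => C * Real.exp (-(δ * t)) * (|z| ^ n * dpow n (t + K)))
    (fun n => Continuous.aestronglyMeasurable (by have := hqc n; fun_prop))
    (fun n => (ae_restrict_iff' measurableSet_Ioi).2 (Eventually.of_forall fun t ht => ?_))
    (Eventually.of_forall fun t => (hexp t).summable) ?_
    (Eventually.of_forall fun t => ?_)
  · simpa only [integral_const_mul, smul_eq_mul] using h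
  · have h1 := hC t ht
    have h2 := hq n t ht
    rw [Real.norm_eq_abs, abs_mul, abs_mul, abs_pow]
    calc |z| ^ n * (|g t| * |q n t|) ≤
          |z| ^ n * (C * Real.exp (-(δ * t)) * dpow n (t + K)) := by gcongr
      _ = _ := by ring
  · simp only [fun t => (hexp t).tsum_eq]
    refine ((integrableOn_exp_neg_mul_Ioi (c := δ - |z|) (by linarith) 0).const_mul
      (C * Real.exp (|z| * K))).congr (Eventually.of_forall fun t => ?_)
    simp only
    rw [mul_assoc, mul_assoc, ← Real.exp_add, ← Real.exp_add]
    ring_nf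
  · refine ((hκ z t).mul_left (g t)).congr_fun fun n => ?_
    ring

theorem hasSum_re_exp (a w : ℂ) (z : ℝ) :
    HasSum (fun n : ℕ => z ^ n * ((a * w ^ n).re / n.factorial)) (a * Complex.exp (z * w)).re := by
  have h := NormedSpace.expSeries_div_hasSum_exp (z * w)
  rw [← Complex.exp_eq_exp_ℂ] at h
  have h2 := Complex.hasSum_re (h.mul_left a)
  refine h2.congr_fun fun n => ?_
  have : a * ((z * w) ^ n / (n.factorial : ℂ)) = ((z ^ n / n.factorial : ℝ) : ℂ) * (a * w ^ n) := by
    push_cast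
    rw [mul_pow]
    ring
  rw [this, Complex.re_ofReal_mul]
  ring

theorem abs_re_div_factorial_le {a w : ℂ} {r : ℝ} (ha : ‖a‖ ≤ 1) (hw : ‖w‖ ≤ r) (n : ℕ) :
    |(a * w ^ n).re / n.factorial| ≤ dpow n r := by
  rw [abs_div, Nat.abs_cast, dpow]
  gcongr
  refine (Complex.abs_re_le_norm _).trans ?_
  rw [norm_mul, norm_pow]
  calc ‖a‖ * ‖w‖ ^ n ≤ 1 * r ^ n := by gcongr
    _ = _ := one_mul _

/-- The kernels in use are built from real parts Re(a e^(zw)), or half-differences of two of them,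
with |a| ≤ 1 and |w| ≤ t + K, so one domination serves for all. -/
theorem eventually_hasSum_re_exp {g : ℝ → ℝ} (hg : Continuous g) {C δ K : ℝ} (hδ : 0 < δ)
    (hC : ∀ t, 0 < t → |g t| ≤ C * Real.exp (-(δ * t))) {a w : ℝ → ℂ} (hac : Continuous a)
    (hwc : Continuous w) (ha : ∀ t, ‖a t‖ ≤ 1) (hw : ∀ t, 0 < t → ‖w t‖ ≤ t + K) :
    ∀ᶠ z : ℝ in 𝓝 0, HasSum
      (fun n => z ^ n • ∫ t in Ioi (0 : ℝ), g t * ((a t * w t ^ n).re / n.factorial))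
      (∫ t in Ioi (0 : ℝ), g t * (a t * Complex.exp ((z : ℂ) * w t)).re) :=
  eventually_hasSum_integral (K := K) hg hδ hC (fun n => by fun_prop)
    (fun n t ht => abs_re_div_factorial_le (ha t) (hw t ht) n) fun z t => hasSum_re_exp _ _ z

theorem eventually_hasSum_re_exp_sub {g : ℝ → ℝ} (hg : Continuous g) {C δ K : ℝ} (hδ : 0 < δ)
    (hC : ∀ t, 0 < t → |g t| ≤ C * Real.exp (-(δ * t))) {a v w : ℝ → ℂ} (hac : Continuous a)
    (hvc : Continuous v) (hwc : Continuous w) (ha : ∀ t, ‖a t‖ ≤ 1)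
    (hv : ∀ t, 0 < t → ‖v t‖ ≤ t + K) (hw : ∀ t, 0 < t → ‖w t‖ ≤ t + K) :
    ∀ᶠ z : ℝ in 𝓝 0, HasSum
      (fun n => z ^ n • ∫ t in Ioi (0 : ℝ), g t *
        (((a t * v t ^ n).re / n.factorial - (a t * w t ^ n).re / n.factorial) / 2))
      (∫ t in Ioi (0 : ℝ), g t *
        (((a t * Complex.exp ((z : ℂ) * v t)).re - (a t * Complex.exp ((z : ℂ) * w t)).re) / 2)) := by
  refine eventually_hasSum_integral (K := K) hg hδ hC (fun n => by fun_prop) (fun n t ht => ?_)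
    fun z t => ?_
  · have h1 := abs_re_div_factorial_le (ha t) (hv t ht) n
    have h2 := abs_re_div_factorial_le (ha t) (hw t ht) n
    rw [abs_le] at *
    constructor <;> linarith
  · refine (((hasSum_re_exp (a t) (v t) z).sub (hasSum_re_exp (a t) (w t) z)).div_const 2).congr_fun
      fun n => ?_
    ring

theorem re_exp_mul_exp (β z u v : ℝ) :
    (Complex.exp (β * Complex.I) * Complex.exp (z * (u + v * Complex.I))).re =
      Real.exp (z * u) * Real.cos (β + z * v) := by
  have : Complex.exp (β * Complex.I) * Complex.exp (z * (u + v * Complex.I)) =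
      Complex.exp ((z * u : ℝ) + (β + z * v : ℝ) * Complex.I) := by
    rw [← Complex.exp_add]
    congr 1
    push_cast
    ring
  rw [this, Complex.exp_re]
  simp only [Complex.add_re, Complex.add_im, Complex.ofReal_re, Complex.ofReal_im,
    Complex.re_ofReal_mul, Complex.im_ofReal_mul, Complex.I_re, Complex.I_im, mul_zero, mul_one,
    add_zero, zero_add]

theorem re_neg_I_mul_exp (z u v : ℝ) :
    (-Complex.I * Complex.exp (z * (u + v * Complex.I))).re =
      Real.exp (z * u) * Real.sin (z * v) := by
  have : (z * (u + v * Complex.I) : ℂ) = (z * u : ℝ) + (z * v : ℝ) * Complex.I := by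
    push_cast
    ring
  rw [this, neg_mul, Complex.neg_re, Complex.I_mul_re, neg_neg, Complex.exp_im]
  simp only [Complex.add_re, Complex.add_im, Complex.ofReal_re, Complex.ofReal_im,
    Complex.re_ofReal_mul, Complex.im_ofReal_mul, Complex.I_re, Complex.I_im, mul_zero, mul_one,
    add_zero, zero_add]

theorem norm_ofReal_add_ofReal_mul_I_le (u v : ℝ) : ‖(u + v * Complex.I : ℂ)‖ ≤ |u| + |v| := by
  refine (norm_add_le _ _).trans ?_
  simp

theorem abs_sinh_mul_sech_le {x t : ℝ} (hx : 0 ≤ x) (ht : 0 < t) :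
    |Real.sinh (x * t) * sech t| ≤ 2 * Real.exp (-((1 - x) * t)) := by
  have h0 : 0 ≤ x * t := by positivity
  rw [abs_mul, abs_of_pos (sech_pos t), abs_of_nonneg (Real.sinh_nonneg_iff.2 h0)]
  have h1 : Real.sinh (x * t) ≤ Real.exp (x * t) := by
    rw [Real.sinh_eq]
    have := Real.exp_pos (x * t)
    have := Real.exp_pos (-(x * t))
    linarith
  calc _ ≤ Real.exp (x * t) * (2 * Real.exp (-t)) :=
        mul_le_mul h1 (sech_le t) (sech_pos t).le (Real.exp_pos _).le
    _ = _ := by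
      rw [show -((1 - x) * t) = x * t + -t by ring, Real.exp_add]
      ring

/-! ### The symmetric identity and comparison of its coefficients. -/

/-- Both sides are analytic in y near 0 and agree for 0 < y < 1. The gain is the validity for
negative y, which the contour argument does not reach. -/
theorem eventually_integral_sinh_cos_symm {x : ℝ} (hx : 0 < x) (hx1 : x < 1) :
    ∀ᶠ y in 𝓝 (0 : ℝ),
      y * (∫ t in Ioi (0 : ℝ), Real.sinh (x * t) *
        Real.cos (Real.pi / 2 * (x + y) - y * gd t) * sech t) =
      x * (∫ t in Ioi (0 : ℝ), Real.sinh (y * t) *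
        Real.cos (Real.pi / 2 * (x + y) - x * gd t) * sech t) := by
  have c1 := continuous_gd
  have c2 := continuous_sech
  have hpi := Real.pi_pos
  have s1 := eventually_hasSum_re_exp (g := fun t => Real.sinh (x * t) * sech t) (by fun_prop)
    (sub_pos.2 hx1) (fun t ht => abs_sinh_mul_sech_le hx.le ht)
    (a := fun _ => Complex.exp ((Real.pi / 2 * x : ℝ) * Complex.I))
    (w := fun t => (0 : ℝ) + (Real.pi / 2 - gd t : ℝ) * Complex.I) (by fun_prop) (by fun_prop)
    (fun t => by rw [Complex.norm_exp_ofReal_mul_I]) (K := Real.pi / 2) (fun t ht => by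
      refine (norm_ofReal_add_ofReal_mul_I_le _ _).trans ?_
      rw [abs_zero, abs_of_nonneg (by linarith [gd_lt_pi_div_two t])]
      linarith [gd_nonneg ht.le])
  have s2 := eventually_hasSum_re_exp_sub (g := sech) c2 one_pos (C := 2)
    (fun t ht => by rw [abs_of_pos (sech_pos t), one_mul]; exact sech_le t)
    (a := fun t => Complex.exp ((x * (Real.pi / 2 - gd t) : ℝ) * Complex.I))
    (v := fun t => (t : ℝ) + (Real.pi / 2 : ℝ) * Complex.I)
    (w := fun t => (-t : ℝ) + (Real.pi / 2 : ℝ) * Complex.I) (by fun_prop) (by fun_prop)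
    (by fun_prop) (fun t => by rw [Complex.norm_exp_ofReal_mul_I]) (K := Real.pi / 2)
    (fun t ht => by
      refine (norm_ofReal_add_ofReal_mul_I_le _ _).trans ?_
      rw [abs_of_pos ht, abs_of_pos (by positivity)])
    (fun t ht => by
      refine (norm_ofReal_add_ofReal_mul_I_le _ _).trans ?_
      rw [abs_neg, abs_of_pos ht, abs_of_pos (by positivity)])
  simp only [re_exp_mul_exp] at s1 s2
  have e1 : ∀ y, ∫ t in Ioi (0 : ℝ), Real.sinh (x * t) * sech t *
      (Real.exp (y * 0) * Real.cos (Real.pi / 2 * x + y * (Real.pi / 2 - gd t))) =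
      ∫ t in Ioi (0 : ℝ), Real.sinh (x * t) *
        Real.cos (Real.pi / 2 * (x + y) - y * gd t) * sech t := fun y => by
    refine integral_congr_ae (Eventually.of_forall fun t => ?_)
    simp only
    rw [mul_zero, Real.exp_zero, one_mul,
      show Real.pi / 2 * x + y * (Real.pi / 2 - gd t) = Real.pi / 2 * (x + y) - y * gd t by ring]
    ring
  have e2 : ∀ y, ∫ t in Ioi (0 : ℝ), sech t *
      ((Real.exp (y * t) * Real.cos (x * (Real.pi / 2 - gd t) + y * (Real.pi / 2)) -
        Real.exp (y * -t) * Real.cos (x * (Real.pi / 2 - gd t) + y * (Real.pi / 2))) / 2) =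
      ∫ t in Ioi (0 : ℝ), Real.sinh (y * t) *
        Real.cos (Real.pi / 2 * (x + y) - x * gd t) * sech t := fun y => by
    refine integral_congr_ae (Eventually.of_forall fun t => ?_)
    simp only
    rw [show x * (Real.pi / 2 - gd t) + y * (Real.pi / 2) = Real.pi / 2 * (x + y) - x * gd t by ring,
      Real.sinh_eq, mul_neg]
    ring
  simp only [e1] at s1
  simp only [e2] at s2
  have s1' := hasSum_shiftCoeff s1 1
  have s2' := hasSum_const_mul_coeff s2 x
  simp only [one_mul] at s1'
  refine eventually_eq_of_hasSum s1' s2' ?_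
  filter_upwards [Ioo_mem_nhdsGT one_pos] with y hy
  exact integral_sinh_cos_symm hx hx1 hy.1 hy.2

/-- Let α, γ = π(x ± y)/2. Weighting the identities at y and -y by cos γ and cos α eliminates the
cosines: cos γ cos(α - u) - cos α cos(γ + u) = sin(α + γ) sin u with α + γ = πx, and cos γ cos(α -
v) - cos α cos(γ - v) = sin(α - γ) sin v with α - γ = πy. -/
theorem eventually_integral_sinh_sin_symm {x : ℝ} (hx : 0 < x) (hx1 : x < 1) :
    ∀ᶠ y in 𝓝[>] (0 : ℝ),
      Real.sin (Real.pi * x) * (y * ∫ t in Ioi (0 : ℝ), Real.sinh (x * t) * sech t *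
        Real.sin (y * gd t)) =
      ∫ t in Ioi (0 : ℝ), x * Real.sin (x * gd t) * sech t *
        (Real.sin (y * Real.pi) * Real.sinh (y * t)) := by
  have h := eventually_integral_sinh_cos_symm hx hx1
  have hneg : ∀ᶠ y in 𝓝 (0 : ℝ),
      -y * (∫ t in Ioi (0 : ℝ), Real.sinh (x * t) *
        Real.cos (Real.pi / 2 * (x + -y) - -y * gd t) * sech t) =
      x * (∫ t in Ioi (0 : ℝ), Real.sinh (-y * t) *
        Real.cos (Real.pi / 2 * (x + -y) - x * gd t) * sech t) := by
    have : Tendsto (fun y : ℝ => -y) (𝓝 0) (𝓝 0) := continuous_neg.tendsto' 0 0 neg_zero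
    exact this.eventually h
  filter_upwards [mem_nhdsWithin_of_mem_nhds h, mem_nhdsWithin_of_mem_nhds hneg,
    Ioo_mem_nhdsGT one_pos] with y h1 h2 hy
  have hxa : |x| < 1 := abs_lt.2 ⟨by linarith, hx1⟩
  have hya : |y| < 1 := abs_lt.2 ⟨by linarith [hy.1], hy.2⟩
  have hya' : |-y| < 1 := by rwa [abs_neg]
  set α := Real.pi / 2 * (x + y) with hα
  set γ := Real.pi / 2 * (x + -y) with hγ
  have e1 : Real.cos γ * (∫ t in Ioi (0 : ℝ), Real.sinh (x * t) * Real.cos (α - y * gd t) * sech t) -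
      Real.cos α * (∫ t in Ioi (0 : ℝ), Real.sinh (x * t) * Real.cos (γ - -y * gd t) * sech t) =
      Real.sin (Real.pi * x) * ∫ t in Ioi (0 : ℝ), Real.sinh (x * t) * sech t *
        Real.sin (y * gd t) := by
    rw [← integral_const_mul, ← integral_const_mul, ← integral_const_mul, ← integral_sub
      ((integrableOn_sinh_cos_sech hxa α y).const_mul _)
      ((integrableOn_sinh_cos_sech hxa γ (-y)).const_mul _)]
    refine integral_congr_ae (Eventually.of_forall fun t => ?_)
    simp only
    rw [show Real.pi * x = α + γ by rw [hα, hγ]; ring, neg_mul, sub_neg_eq_add, Real.cos_add γ,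
      Real.cos_sub, Real.sin_add]
    ring
  have e2 : Real.cos γ * (∫ t in Ioi (0 : ℝ), Real.sinh (y * t) * Real.cos (α - x * gd t) * sech t) +
      Real.cos α * (∫ t in Ioi (0 : ℝ), Real.sinh (-y * t) * Real.cos (γ - x * gd t) * sech t) =
      ∫ t in Ioi (0 : ℝ), Real.sin (x * gd t) * sech t *
        (Real.sin (y * Real.pi) * Real.sinh (y * t)) := by
    rw [← integral_const_mul, ← integral_const_mul, ← integral_add
      ((integrableOn_sinh_cos_sech hya α x).const_mul _)
      ((integrableOn_sinh_cos_sech hya' γ x).const_mul _)]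
    refine integral_congr_ae (Eventually.of_forall fun t => ?_)
    simp only
    rw [show y * Real.pi = α - γ by rw [hα, hγ]; ring, neg_mul, Real.sinh_neg, Real.cos_sub γ,
      Real.cos_sub, Real.sin_sub]
    ring
  have e3 : ∫ t in Ioi (0 : ℝ), x * Real.sin (x * gd t) * sech t *
        (Real.sin (y * Real.pi) * Real.sinh (y * t)) =
      x * ∫ t in Ioi (0 : ℝ), Real.sin (x * gd t) * sech t *
        (Real.sin (y * Real.pi) * Real.sinh (y * t)) := by
    rw [← integral_const_mul]
    simp only [mul_assoc]
  rw [e3, ← e2]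
  linear_combination (-y) * e1 + Real.cos γ * h1 + Real.cos α * h2

/-- `Im (t + i π)^{2m} / (2m)!`. -/
noncomputable def imPow (m : ℕ) (t : ℝ) : ℝ :=
  ((t + Real.pi * Complex.I : ℂ) ^ (2 * m)).im / (2 * m).factorial

/-- In the binomial expansion even powers of iπ are real, so only odd powers of t contribute, with
sinc coefficients after one factor π is taken out. -/
theorem imPow_eq_sum (m : ℕ) (t : ℝ) :
    imPow m t = Real.pi * ∑ j ∈ Finset.range m, sincCoeff (m - 1 - j) * dpow (2 * j + 1) t := by
  have hev : ∀ n : ℕ, (Real.pi * Complex.I) ^ (2 * n) = (((-1) ^ n * Real.pi ^ (2 * n) : ℝ) : ℂ) := by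
    intro n
    rw [mul_pow, pow_mul Complex.I, Complex.I_sq]
    push_cast
    ring
  have key : ((t + Real.pi * Complex.I : ℂ) ^ (2 * m)).im =
      ∑ l ∈ Finset.range (2 * m + 1), ((t : ℂ) ^ l * (Real.pi * Complex.I) ^ (2 * m - l) *
        ((2 * m).choose l : ℂ)).im := by
    rw [add_pow, Complex.im_sum]
  have him : ∀ a b c : ℝ, ((a : ℂ) * b * c).im = 0 := fun a b c => by
    rw [← Complex.ofReal_mul, ← Complex.ofReal_mul, Complex.ofReal_im]
  rw [imPow, key, Finset.sum_range_succ, sum_range_two_mul, Finset.mul_sum, add_div, Finset.sum_div]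
  have hlast : ((t : ℂ) ^ (2 * m) * (Real.pi * Complex.I) ^ (2 * m - 2 * m) *
      ((2 * m).choose (2 * m) : ℂ)).im = 0 := by
    rw [Nat.sub_self, pow_zero, Nat.choose_self, Nat.cast_one, ← Complex.ofReal_pow,
      ← Complex.ofReal_one]
    exact him _ _ _
  rw [hlast, zero_div, add_zero]
  refine Finset.sum_congr rfl fun j hj => ?_
  rw [Finset.mem_range] at hj
  obtain ⟨f, rfl⟩ : ∃ f, m = j + 1 + f := ⟨m - (j + 1), by omega⟩
  rw [show 2 * (j + 1 + f) - 2 * j = 2 * (f + 1) by omega,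
    show 2 * (j + 1 + f) - (2 * j + 1) = 2 * f + 1 by omega, show j + 1 + f - 1 - j = f by omega,
    hev, pow_succ _ (2 * f), hev, ← Complex.ofReal_pow, ← Complex.ofReal_pow,
    ← Complex.ofReal_natCast, ← Complex.ofReal_natCast, him, zero_add]
  have h1 : ((t ^ (2 * j + 1) : ℝ) : ℂ) * ((((-1) ^ f * Real.pi ^ (2 * f) : ℝ) : ℂ) *
      (Real.pi * Complex.I)) * (((2 * (j + 1 + f)).choose (2 * j + 1) : ℝ) : ℂ) =
      ((t ^ (2 * j + 1) * ((-1) ^ f * Real.pi ^ (2 * f)) * Real.pi *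
        ((2 * (j + 1 + f)).choose (2 * j + 1) : ℝ) : ℝ) : ℂ) * Complex.I := by
    push_cast
    ring
  have hch : ((2 * (j + 1 + f)).choose (2 * j + 1) : ℝ) =
      (2 * (j + 1 + f)).factorial / ((2 * j + 1).factorial * (2 * f + 1).factorial) := by
    rw [Nat.cast_choose ℝ (by omega), show 2 * (j + 1 + f) - (2 * j + 1) = 2 * f + 1 by omega]
  rw [h1, Complex.im_ofReal_mul, Complex.I_im, mul_one, hch, sincCoeff, dpow]
  have : ((2 * (j + 1 + f)).factorial : ℝ) ≠ 0 := by positivity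
  field_simp

theorem continuous_imPow (m : ℕ) : Continuous (imPow m) := by
  unfold imPow
  fun_prop

theorem abs_imPow_le (m : ℕ) {t : ℝ} (ht : 0 < t) : |imPow m t| ≤ dpow (2 * m) (t + Real.pi) := by
  have hpi := Real.pi_pos
  have h := abs_re_div_factorial_le (a := -Complex.I) (w := t + Real.pi * Complex.I)
    (r := t + Real.pi) (by simp) ((norm_ofReal_add_ofReal_mul_I_le _ _).trans_eq (by
      rw [abs_of_pos ht, abs_of_pos hpi])) (2 * m)
  rwa [neg_mul, Complex.neg_re, Complex.I_mul_re, neg_neg] at h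

/-- The expansion in `z` of the transform with kernel `sin (z gd t)`. -/
theorem eventually_hasSum_sin {g : ℝ → ℝ} (hg : Continuous g) {C δ : ℝ} (hδ : 0 < δ)
    (hC : ∀ t, 0 < t → |g t| ≤ C * Real.exp (-(δ * t))) :
    ∃ c : ℕ → ℝ, (∀ k, c (2 * k + 1) =
        (-1) ^ k * ∫ t in Ioi (0 : ℝ), g t * dpow (2 * k + 1) (gd t)) ∧
      ∀ᶠ z in 𝓝 (0 : ℝ), HasSum (fun n => z ^ n • c n)
        (∫ t in Ioi (0 : ℝ), g t * Real.sin (z * gd t)) := by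
  have c1 := continuous_gd
  have s := eventually_hasSum_re_exp hg hδ hC (a := fun _ => -Complex.I)
    (w := fun t => (0 : ℝ) + (gd t : ℝ) * Complex.I) (by fun_prop) (by fun_prop)
    (fun t => by simp) (K := Real.pi / 2) (fun t ht => by
      refine (norm_ofReal_add_ofReal_mul_I_le _ _).trans ?_
      rw [abs_zero, abs_of_nonneg (gd_nonneg ht.le)]
      linarith [gd_lt_pi_div_two t])
  simp only [re_neg_I_mul_exp, mul_zero, Real.exp_zero, one_mul] at s
  refine ⟨_, fun k => ?_, s⟩
  rw [← integral_const_mul]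
  refine integral_congr_ae (Eventually.of_forall fun t => ?_)
  simp only
  have : -Complex.I * ((0 : ℝ) + gd t * Complex.I) ^ (2 * k + 1) =
      (((-1) ^ k * gd t ^ (2 * k + 1) : ℝ) : ℂ) := by
    rw [Complex.ofReal_zero, zero_add, mul_pow, pow_succ Complex.I, pow_mul Complex.I,
      Complex.I_sq]
    push_cast
    linear_combination (-(gd t : ℂ) ^ (2 * k + 1) * (-1) ^ k) * Complex.I_mul_I
  rw [this, Complex.ofReal_re, dpow]
  ring

/-- The expansion in `z` of the transform with kernel `sin (z π) sinh (z t)`. -/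
theorem eventually_hasSum_sin_sinh {g : ℝ → ℝ} (hg : Continuous g) {C δ : ℝ} (hδ : 0 < δ)
    (hC : ∀ t, 0 < t → |g t| ≤ C * Real.exp (-(δ * t))) :
    ∃ c : ℕ → ℝ, (∀ m, c (2 * m) = ∫ t in Ioi (0 : ℝ), g t * imPow m t) ∧
      ∀ᶠ z in 𝓝 (0 : ℝ), HasSum (fun n => z ^ n • c n)
        (∫ t in Ioi (0 : ℝ), g t * (Real.sin (z * Real.pi) * Real.sinh (z * t))) := by
  have hpi := Real.pi_pos
  have s := eventually_hasSum_re_exp_sub hg hδ hC (a := fun _ => -Complex.I)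
    (v := fun t => (t : ℝ) + (Real.pi : ℝ) * Complex.I)
    (w := fun t => (-t : ℝ) + (Real.pi : ℝ) * Complex.I) (by fun_prop) (by fun_prop)
    (by fun_prop) (fun t => by simp) (K := Real.pi)
    (fun t ht => by
      refine (norm_ofReal_add_ofReal_mul_I_le _ _).trans ?_
      rw [abs_of_pos ht, abs_of_pos (by positivity)])
    (fun t ht => by
      refine (norm_ofReal_add_ofReal_mul_I_le _ _).trans ?_
      rw [abs_neg, abs_of_pos ht, abs_of_pos (by positivity)])
  simp only [re_neg_I_mul_exp] at s
  have e : ∀ z, ∫ t in Ioi (0 : ℝ), g t * ((Real.exp (z * t) * Real.sin (z * Real.pi) -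
      Real.exp (z * -t) * Real.sin (z * Real.pi)) / 2) =
      ∫ t in Ioi (0 : ℝ), g t * (Real.sin (z * Real.pi) * Real.sinh (z * t)) := fun z => by
    refine integral_congr_ae (Eventually.of_forall fun t => ?_)
    simp only
    rw [Real.sinh_eq, mul_neg]
    ring
  simp only [e] at s
  refine ⟨_, fun m => ?_, s⟩
  refine integral_congr_ae (Eventually.of_forall fun t => ?_)
  simp only
  -- For an even exponent the two powers are conjugate, so half the difference of their imaginary
  -- parts is the imaginary part of the first.
  have h1 : ((-t : ℝ) + Real.pi * Complex.I : ℂ) ^ (2 * m) =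
      (starRingEnd ℂ) ((t + Real.pi * Complex.I : ℂ) ^ (2 * m)) := by
    rw [map_pow, pow_mul, pow_mul]
    congr 1
    simp only [map_add, map_mul, Complex.conj_ofReal, Complex.conj_I]
    push_cast
    ring
  rw [h1]
  simp only [neg_mul, Complex.neg_re, Complex.I_mul_re, neg_neg, Complex.conj_im, imPow]
  ring

/-- The coefficient of y^(2k+2) in the symmetric identity. -/
theorem sin_mul_integral_sinh_dpow {x : ℝ} (hx : 0 < x) (hx1 : x < 1) (k : ℕ) :
    Real.sin (Real.pi * x) * ((-1) ^ k *
        ∫ t in Ioi (0 : ℝ), Real.sinh (x * t) * sech t * dpow (2 * k + 1) (gd t)) =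
      ∫ t in Ioi (0 : ℝ), x * Real.sin (x * gd t) * sech t * imPow (k + 1) t := by
  have c1 := continuous_gd
  have c2 := continuous_sech
  obtain ⟨c, hc, hcs⟩ := eventually_hasSum_sin (g := fun t => Real.sinh (x * t) * sech t)
    (by fun_prop) (sub_pos.2 hx1) (fun t ht => abs_sinh_mul_sech_le hx.le ht)
  obtain ⟨d, hd, hds⟩ := eventually_hasSum_sin_sinh
    (g := fun t => x * Real.sin (x * gd t) * sech t) (by fun_prop) one_pos (C := 2) (fun t _ => by
      rw [abs_mul, abs_mul, abs_of_pos hx, abs_of_pos (sech_pos t), one_mul]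
      calc _ ≤ 1 * 1 * (2 * Real.exp (-t)) := by
            gcongr
            · exact (sech_pos t).le
            · exact Real.abs_sin_le_one _
            · exact sech_le t
        _ = _ := by ring)
  have h := coeff_eq_of_hasSum (hasSum_shiftCoeff hcs (Real.sin (Real.pi * x))) hds
    (eventually_integral_sinh_sin_symm hx hx1) (2 * (k + 1))
  rw [hd, show 2 * (k + 1) = 2 * k + 1 + 1 by ring, shiftCoeff, hc] at h
  exact h

/-- The coefficient of x^(2l+2) in `sin_mul_integral_sinh_dpow`, where x now plays the role of the
expansion variable. -/
theorem integral_imPow_symm (k l : ℕ) :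
    (-1) ^ k * ∫ t in Ioi (0 : ℝ), dpow (2 * k + 1) (gd t) * sech t * imPow (l + 1) t =
      (-1) ^ l * ∫ t in Ioi (0 : ℝ), dpow (2 * l + 1) (gd t) * sech t * imPow (k + 1) t := by
  have c1 := continuous_gd
  have c2 := continuous_sech
  have c3 := continuous_dpow (2 * k + 1)
  have c4 := continuous_imPow (k + 1)
  have hpi := Real.pi_pos
  obtain ⟨c, hc, hcs⟩ := eventually_hasSum_sin (g := fun t => imPow (k + 1) t * sech t)
    (by fun_prop) (half_pos one_pos) (C := 2 ^ (2 * (k + 1)) * Real.exp (Real.pi / 2) * 2)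
    (fun t ht => by
      rw [abs_mul, abs_of_pos (sech_pos t)]
      have h1 := (abs_imPow_le (k + 1) ht).trans (dpow_le_exp _ (by positivity))
      calc _ ≤ 2 ^ (2 * (k + 1)) * Real.exp ((t + Real.pi) / 2) * (2 * Real.exp (-t)) :=
            mul_le_mul h1 (sech_le t) (sech_pos t).le (by positivity)
        _ = _ := by
          rw [show (t + Real.pi) / 2 = Real.pi / 2 + t / 2 by ring,
            show -(1 / 2 * t) = t / 2 + -t by ring, Real.exp_add, Real.exp_add]
          ring)
  obtain ⟨d, hd, hds⟩ := eventually_hasSum_sin_sinh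
    (g := fun t => dpow (2 * k + 1) (gd t) * sech t) (by fun_prop) one_pos
    (C := dpow (2 * k + 1) (Real.pi / 2) * 2) (fun t ht => by
      rw [abs_mul, abs_of_pos (sech_pos t), abs_of_nonneg (dpow_nonneg _ (gd_nonneg ht.le)),
        one_mul, mul_assoc]
      exact mul_le_mul (dpow_le_dpow _ (gd_nonneg ht.le) (gd_lt_pi_div_two t).le) (sech_le t)
        (sech_pos t).le (dpow_nonneg _ (by positivity)))
  have h := coeff_eq_of_hasSum hds (hasSum_shiftCoeff hcs ((-1) ^ k)) ?_ (2 * (l + 1))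
  · rw [hd, show 2 * (l + 1) = 2 * l + 1 + 1 by ring, shiftCoeff, hc] at h
    rw [h]
    have hk : ((-1 : ℝ) ^ k) * (-1) ^ k = 1 := by rw [← mul_pow]; norm_num
    rw [← mul_assoc, hk, one_mul]
    congr 1
    refine integral_congr_ae (Eventually.of_forall fun t => ?_)
    simp only
    ring
  · filter_upwards [Ioo_mem_nhdsGT one_pos] with x hx
    have h := sin_mul_integral_sinh_dpow hx.1 hx.2 k
    have hk : ((-1 : ℝ) ^ k) * (-1) ^ k = 1 := by rw [← mul_pow]; norm_num
    have e1 : ∫ t in Ioi (0 : ℝ), dpow (2 * k + 1) (gd t) * sech t *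
        (Real.sin (x * Real.pi) * Real.sinh (x * t)) =
        Real.sin (Real.pi * x) *
          ∫ t in Ioi (0 : ℝ), Real.sinh (x * t) * sech t * dpow (2 * k + 1) (gd t) := by
      rw [← integral_const_mul]
      refine integral_congr_ae (Eventually.of_forall fun t => ?_)
      simp only
      rw [mul_comm x Real.pi]
      ring
    have e2 : x * ∫ t in Ioi (0 : ℝ), imPow (k + 1) t * sech t * Real.sin (x * gd t) =
        ∫ t in Ioi (0 : ℝ), x * Real.sin (x * gd t) * sech t * imPow (k + 1) t := by
      rw [← integral_const_mul]
      refine integral_congr_ae (Eventually.of_forall fun t => ?_)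
      simp only
      ring
    rw [e1, e2, ← h]
    linear_combination (-(Real.sin (Real.pi * x) *
      ∫ t in Ioi (0 : ℝ), Real.sinh (x * t) * sech t * dpow (2 * k + 1) (gd t))) * hk

theorem integrableOn_dpow_gd_sech (a b : ℕ) :
    IntegrableOn (fun t => dpow a t * dpow b (gd t) * sech t) (Ioi 0) := by
  simpa [gd_zero] using integrableOn_gdMoment a b le_rfl

/-- The weights Z(j, l+1) are exactly the sinc coefficients in the expansion of `imPow (l + 1)`, so
the integral representation of W can be summed under the integral sign. -/
theorem sum_W_mul_Z (k l : ℕ) :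
    Real.pi * ∑ j ∈ Finset.Icc 1 (l + 1), W (2 * j + 2 * (k + 1) - 1) (2 * (k + 1)) * Z j (l + 1) =
      ∫ t in Ioi (0 : ℝ), dpow (2 * k + 1) (gd t) * sech t * imPow (l + 1) t := by
  have e : ∀ t, dpow (2 * k + 1) (gd t) * sech t * imPow (l + 1) t =
      ∑ j ∈ Finset.range (l + 1), Real.pi * sincCoeff (l - j) *
        (dpow (2 * j + 1) t * dpow (2 * k + 1) (gd t) * sech t) := fun t => by
    rw [imPow_eq_sum, Finset.mul_sum, Finset.mul_sum]
    refine Finset.sum_congr rfl fun j _ => ?_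
    rw [Nat.add_sub_cancel]
    ring
  simp only [e]
  rw [integral_finsetSum _ fun j _ => (integrableOn_dpow_gd_sech _ _).const_mul _,
    sum_Icc_one_eq_sum_range, Finset.mul_sum]
  refine Finset.sum_congr rfl fun j hj => ?_
  rw [Finset.mem_range] at hj
  rw [integral_const_mul, W_eq_integral (by omega) (by omega),
    show l + 1 = j + 1 + (l - j) by omega, Z_eq_sincCoeff]
  simp only [show 2 * (j + 1) - 1 = 2 * j + 1 by omega, show 2 * (k + 1) - 1 = 2 * k + 1 by omega]
  ring

end AltMTV

theorem theorem1p1 (m p : ℕ) (hm : 1 ≤ m) (hp : 1 ≤ p) :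
    (∀ r : ℕ, 1 ≤ r → ∀ κ : Fin r → ℕ, (∀ i, 1 ≤ κ i) →
      ∃ L : ℝ, Tendsto (AltMTV.TBarPartial κ) atTop (𝓝 L)) ∧
    (∀ s : ℕ, 1 ≤ s → ∃ L : ℝ, Tendsto (AltMTV.zetaBarPartial s) atTop (𝓝 L)) ∧
    (-1 : ℝ) ^ m * ∑ j ∈ Finset.Icc 1 p, AltMTV.W (2 * j + 2 * m - 1) (2 * m) * AltMTV.Z j p =
      (-1 : ℝ) ^ p * ∑ j ∈ Finset.Icc 1 m, AltMTV.W (2 * j + 2 * p - 1) (2 * p) * AltMTV.Z j m := by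
  refine ⟨fun r hr κ hκ => ?_, fun s hs => AltMTV.exists_tendsto_zetaBarPartial hs, ?_⟩
  · obtain ⟨r, rfl⟩ : ∃ q, r = q + 1 := ⟨r - 1, by omega⟩
    exact AltMTV.exists_tendsto_TBarPartial κ hκ
  · obtain ⟨k, rfl⟩ : ∃ k, m = k + 1 := ⟨m - 1, by omega⟩
    obtain ⟨l, rfl⟩ : ∃ l, p = l + 1 := ⟨p - 1, by omega⟩
    have h := AltMTV.integral_imPow_symm k l
    rw [← AltMTV.sum_W_mul_Z, ← AltMTV.sum_W_mul_Z] at h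
    refine mul_left_cancel₀ Real.pi_ne_zero ?_
    rw [pow_succ, pow_succ]
    linear_combination -h
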